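/- Let $L,H,\kappa,\varepsilon_+,\varepsilon_->0$ and $\theta\in\mathbb R$, and put $\Omega=(0,L)\times(-H,H)$, $\alpha_n=\kappa\sqrt{\varepsilon_+}\sin\theta+2\pi n/L$ for $n\in\mathbb Z$, and $$\beta_n^\pm=\begin{cases}\sqrt{\kappa^2\varepsilon_\pm-\alpha_n^2}, & \alpha_n^2<\kappa^2\varepsilon_\pm,\\ i\sqrt{\alpha_n^2-\kappa^2\varepsilon_\pm}, & \alpha_n^2\ge\kappa^2\varepsilon_\pm.\end{cases}$$ Let $H^1_{qp}(\Omega)$ be the completion, in the norm $\|w\|_{H^1(\Omega)}=(\|w\|_{L^2(\Omega)}^2+|w|_{H^1(\Omega)}^2)^{1/2}$ with $|w|_{H^1(\Omega)}=\|\nabla w\|_{L^2(\Omega)}$, of the (restrictions to $\Omega$ of) functions $\varphi\in C^\infty(\mathbb R^2;\mathbb C)$ with $\varphi(x_1+L,x_2)=e^{i\alpha_0L}\varphi(x_1,x_2)$. For $w\in H^1_{qp}(\Omega)$ let $w_n(\pm H)=\frac1L\int_0^L w(x_1,\pm H)e^{-i\alpha_nx_1}\,dx_1$ be the Fourier coefficients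 of its traces on $\Gamma_{\pm H}=(0,L)\times\{\pm H\}$, let $T^\pm w=\frac{i}{\varepsilon_\pm}\sum_{n}\beta_n^\pm w_n(\pm H)e^{i\alpha_nx_1}$ be the Dirichlet-to-Neumann operators, with the boundary integrals understood as duality pairings $$\int_{\Gamma_{\pm H}}\overline v\,T^\pm(w)=L\,\frac{i}{\varepsilon_\pm}\sum_{n\in\mathbb Z}\beta_n^\pm\,w_n(\pm H)\,\overline{v_n(\pm H)},$$ and for $\varepsilon\in L^\infty(\Omega;\mathbb C)$ with $1/\varepsilon\in L^\infty(\Omega;\mathbb C)$ let $$B_\varepsilon(w,v)=\int_\Omega\Big(\frac1\varepsilon\nabla w\cdot\nabla\overline v-\kappa^2w\overline v\Big)-\int_{\Gamma_{-H}}\overline v\,T^-(w)-\int_{\Gamma_H}\overline v\,T^+(w),\qquad w,v\in H^1_{qp}(\Omega).$$ Then the series defining the boundary integrals converge absolutely for all $w,v\in H^1_{qp}(\Omega)$, and there is a constant $C>0$, depending only on $L,H,\kappa,\varepsilon_+,\varepsilon_-,\theta$, such that $$\|w\|_{L^2(\Omega)}^2\le C\Big(|w|_{H^1(\Omega)}^2+\operatorname{Im}\int_{\Gamma_H}\overline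 w\,T^+(w)\Big)\qquad\text{for all }w\in H^1_{qp}(\Omega),$$ and such that the following holds. Let $\varepsilon\in L^\infty(\Omega;\mathbb C)$ satisfy $\operatorname{Im}\varepsilon>c_1$ and $\operatorname{Re}\varepsilon>c_2$ a.e. in $\Omega$ for some constants $c_1,c_2>0$. Then $B_\varepsilon$ is coercive on $H^1_{qp}(\Omega)$: there is $c>0$ with $|B_\varepsilon(w,w)|\ge c\|w\|_{H^1(\Omega)}^2$ for all $w\in H^1_{qp}(\Omega)$. More precisely, with $$\sigma=\operatorname*{ess\,inf}_\Omega\min\Big(\frac{\operatorname{Re}\varepsilon}{|\varepsilon|^2},1\Big),\qquad \lambda=\frac1C\operatorname*{ess\,inf}_\Omega\min\Big(\frac{\operatorname{Im}\varepsilon}{|\varepsilon|^2},1\Big),\qquad \gamma=\kappa^2+1,$$ one has $\sigma>0$, $\lambda>0$ and $$|B_\varepsilon(w,w)|\ge\frac{\sigma}{\sqrt{1+2(\gamma/\lambda)^2}}\,\|w\|_{H^1(\Omega)}^2\qquad\text{for all }w\in H^1_{qp}(\Omega).$$ -/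

import Mathlib

open MeasureTheory
open scoped ENNReal ContDiff ComplexConjugate

noncomputable section

namespace RCWA

/-- The parameters of the scattering problem: the period `L` of the grating, the half-height `H`
of the computational cell, the wavenumber `κ`, the constant relative permittivities above and below
the cell, and the angle of incidence `θ`. -/
structure Setup where
  L : ℝ
  H : ℝ
  κ : ℝ
  epsTop : ℝ
  epsBot : ℝ
  θ : ℝ
  L_pos : 0 < L
  H_pos : 0 < H
  κ_pos : 0 < κ
  epsTop_pos : 0 < epsTop
  epsBot_pos : 0 < epsBot

namespace Setup

variable (S : Setup)

/-- The cell `Ω = (0, L) × (-H, H)`. -/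
def cell : Set (ℝ × ℝ) := Set.Ioo 0 S.L ×ˢ Set.Ioo (-S.H) S.H

/-- Lebesgue measure on `Ω`. -/
abbrev cellMeasure : Measure (ℝ × ℝ) := volume.restrict S.cell

/-- Lebesgue measure on `(0, L)`, which parametrizes the horizontal sections of `Ω`. -/
abbrev lineMeasure : Measure ℝ := volume.restrict (Set.Ioo 0 S.L)

/-- `αₙ = κ √ε₊ sin θ + 2πn / L`. -/
def alpha (n : ℤ) : ℝ := S.κ * √S.epsTop * Real.sin S.θ + n * (2 * Real.pi / S.L)

/-- `Lᵖ` membership, for every `p`, of continuous functions on the bounded set `Ω`. -/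
theorem memLp_cell {f : ℝ × ℝ → ℂ} (hf : Continuous f) (p : ℝ≥0∞) : MemLp f p S.cellMeasure := by
  have hK : IsCompact (Set.Icc (0 : ℝ) S.L ×ˢ Set.Icc (-S.H) S.H) :=
    isCompact_Icc.prod isCompact_Icc
  have hsub : S.cell ⊆ Set.Icc (0 : ℝ) S.L ×ˢ Set.Icc (-S.H) S.H :=
    Set.prod_mono Set.Ioo_subset_Icc_self Set.Ioo_subset_Icc_self
  have hm : MeasurableSet S.cell := measurableSet_Ioo.prod measurableSet_Ioo
  obtain ⟨C, hC⟩ := hK.exists_bound_of_continuousOn hf.continuousOn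
  have : IsFiniteMeasure S.cellMeasure :=
    ⟨by rw [Measure.restrict_apply_univ]; exact (measure_mono hsub).trans_lt hK.measure_lt_top⟩
  exact MemLp.of_bound hf.aestronglyMeasurable C
    ((ae_restrict_mem hm).mono fun x hx => hC x (hsub hx))

/-- `Lᵖ` membership of continuous functions on `(0, L)`. -/
theorem memLp_line {f : ℝ → ℂ} (hf : Continuous f) (p : ℝ≥0∞) : MemLp f p S.lineMeasure := by
  obtain ⟨C, hC⟩ := (isCompact_Icc (a := (0 : ℝ)) (b := S.L)).exists_bound_of_continuousOn
    hf.continuousOn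
  exact MemLp.of_bound hf.aestronglyMeasurable C
    ((ae_restrict_mem measurableSet_Ioo).mono fun x hx => hC x (Set.Ioo_subset_Icc_self hx))

/-- The smooth functions on the plane that are quasi-periodic in the first variable:
`φ (x₁ + L, x₂) = exp (i α₀ L) φ (x₁, x₂)`. -/
def smoothQP : Submodule ℂ (ℝ × ℝ → ℂ) where
  carrier := {φ | ContDiff ℝ ∞ φ ∧
    ∀ x y : ℝ, φ (x + S.L, y) = Complex.exp (Complex.I * S.alpha 0 * S.L) * φ (x, y)}
  add_mem' := by
    rintro φ ψ ⟨h1, h2⟩ ⟨h3, h4⟩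
    exact ⟨h1.add h3, fun x y => by simp only [Pi.add_apply, h2, h4]; ring⟩
  zero_mem' := ⟨contDiff_const, fun x y => by simp⟩
  smul_mem' := by
    rintro c φ ⟨h1, h2⟩
    exact ⟨h1.const_smul c, fun x y => by simp only [Pi.smul_apply, h2, smul_eq_mul]; ring⟩

variable {S} in
theorem smoothQP_differentiable (φ : S.smoothQP) : Differentiable ℝ (φ : ℝ × ℝ → ℂ) :=
  φ.2.1.differentiable (by simp)

variable {S} in
theorem smoothQP_continuous (φ : S.smoothQP) : Continuous (φ : ℝ × ℝ → ℂ) :=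
  φ.2.1.continuous

variable {S} in
theorem smoothQP_continuous_deriv (φ : S.smoothQP) (v : ℝ × ℝ) :
    Continuous fun p => fderiv ℝ (φ : ℝ × ℝ → ℂ) p v :=
  (φ.2.1.continuous_fderiv (by simp)).clm_apply continuous_const

/-- `L²(Ω)`. -/
abbrev L2Cell := Lp ℂ 2 S.cellMeasure

/-- `L²(Ω)³` with its Hilbert norm; `H¹(Ω)` embeds isometrically by `w ↦ (w, ∂₁w, ∂₂w)`. -/
abbrev L2Cell3 := PiLp 2 fun _ : Fin 3 => S.L2Cell

/-- The embedding `φ ↦ (φ, ∂₁φ, ∂₂φ)` of the smooth quasi-periodic functions into `L²(Ω)³`. The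
norm of the image is the `H¹(Ω)` norm of `φ`. -/
def jet : S.smoothQP →ₗ[ℂ] S.L2Cell3 where
  toFun φ := WithLp.toLp 2
    ![(S.memLp_cell (smoothQP_continuous φ) 2).toLp _,
      (S.memLp_cell (smoothQP_continuous_deriv φ (1, 0)) 2).toLp _,
      (S.memLp_cell (smoothQP_continuous_deriv φ (0, 1)) 2).toLp _]
  map_add' φ ψ := by
    ext1 i
    have h : ∀ v p, fderiv ℝ ((φ + ψ : S.smoothQP) : ℝ × ℝ → ℂ) p v =
        fderiv ℝ (φ : ℝ × ℝ → ℂ) p v + fderiv ℝ (ψ : ℝ × ℝ → ℂ) p v := fun v p => by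
      have := fderiv_add (smoothQP_differentiable φ p) (smoothQP_differentiable ψ p)
      exact congrArg (fun T => T v) this
    fin_cases i <;> simp <;> rw [← MemLp.toLp_add] <;> apply MemLp.toLp_congr
    · exact .of_forall (h _)
    · exact .of_forall (h _)
  map_smul' c φ := by
    ext1 i
    have h : ∀ v p, fderiv ℝ ((c • φ : S.smoothQP) : ℝ × ℝ → ℂ) p v =
        c • fderiv ℝ (φ : ℝ × ℝ → ℂ) p v := fun v p => by
      have := fderiv_const_smul (smoothQP_differentiable φ p) c
      exact congrArg (fun T => T v) this
    fin_cases i <;> simp <;> rw [← MemLp.toLp_const_smul] <;> apply MemLp.toLp_congr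
    · exact .of_forall (h _)
    · exact .of_forall (h _)

/-- `H¹_qp(Ω)`: the completion of the smooth quasi-periodic functions in the `H¹(Ω)` norm, realized
as the closure of their image in the Hilbert space `L²(Ω)³`. An element is a triple
`(w, ∂₁w, ∂₂w)`, and its norm is `(‖w‖² + ‖∂₁w‖² + ‖∂₂w‖²)^(1/2)`, the `H¹(Ω)` norm. -/
def H1qp : Submodule ℂ S.L2Cell3 := (LinearMap.range S.jet).topologicalClosure

/-- The smooth quasi-periodic functions as elements of `H¹_qp(Ω)`. -/
def ofSmooth : S.smoothQP →ₗ[ℂ] S.H1qp :=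
  S.jet.codRestrict S.H1qp fun φ => Submodule.le_topologicalClosure _ ⟨φ, rfl⟩

/-- The restriction of a smooth quasi-periodic function to the segment at height `s`. -/
def restrictLine (s : ℝ) : S.smoothQP →ₗ[ℂ] Lp ℂ 2 S.lineMeasure where
  toFun φ := (S.memLp_line (f := fun x => (φ : ℝ × ℝ → ℂ) (x, s))
    ((smoothQP_continuous φ).comp (by fun_prop)) 2).toLp _
  map_add' φ ψ := rfl
  map_smul' c φ := rfl

/-- The trace operator `H¹_qp(Ω) → L²(0, L)` at height `s ∈ [-H, H]`: the continuous extension of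
the restriction of smooth functions, see `trace_ofSmooth`. -/
def trace (s : ℝ) : S.H1qp →L[ℂ] Lp ℂ 2 S.lineMeasure := (S.restrictLine s).extendOfNorm S.ofSmooth

theorem denseRange_ofSmooth : DenseRange S.ofSmooth := by
  intro w
  rw [closure_subtype]
  have hw : (w : S.L2Cell3) ∈ closure (Set.range S.jet) := w.2
  refine closure_mono ?_ hw
  rintro _ ⟨φ, rfl⟩
  exact ⟨S.ofSmooth φ, ⟨φ, rfl⟩, rfl⟩

/-- One-dimensional trace inequality. -/
theorem sq_norm_le_integral {f g : ℝ → ℂ} (hf : ∀ t, HasDerivAt f (g t) t) (hg : Continuous g)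
    {h s : ℝ} (hs : s ∈ Set.Icc (-h) h) :
    2 * h * ‖f s‖ ^ 2 ≤ ∫ t in (-h)..h, ((1 + 2 * h) * ‖f t‖ ^ 2 + 2 * h * ‖g t‖ ^ 2) := by
  obtain ⟨hs1, hs2⟩ := hs
  have hfc : Continuous f := continuous_iff_continuousAt.2 fun t => (hf t).continuousAt
  have hder : ∀ c t, HasDerivAt (fun t => (t - c) * ‖f t‖ ^ 2)
      (‖f t‖ ^ 2 + (t - c) * (2 * inner ℝ (f t) (g t))) t := fun c t => by
    have h1 := ((hasDerivAt_id t).sub_const c).fun_mul (hf t).norm_sq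
    rw [one_mul] at h1
    exact h1
  have hcont : ∀ c, Continuous fun t => ‖f t‖ ^ 2 + (t - c) * (2 * inner ℝ (f t) (g t)) :=
    fun c => by fun_prop
  have hcont' : Continuous fun t => (1 + 2 * h) * ‖f t‖ ^ 2 + 2 * h * ‖g t‖ ^ 2 := by fun_prop
  have hle : ∀ c t, |t - c| ≤ 2 * h → ‖f t‖ ^ 2 + (t - c) * (2 * inner ℝ (f t) (g t)) ≤
      (1 + 2 * h) * ‖f t‖ ^ 2 + 2 * h * ‖g t‖ ^ 2 := fun c t hc => by
    have h1 : (t - c) * (2 * inner ℝ (f t) (g t)) ≤ |t - c| * (2 * (‖f t‖ * ‖g t‖)) := by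
      refine (le_abs_self _).trans ?_
      rw [abs_mul, abs_mul, abs_two]
      gcongr
      exact abs_real_inner_le_norm _ _
    have h2 : 2 * (‖f t‖ * ‖g t‖) ≤ ‖f t‖ ^ 2 + ‖g t‖ ^ 2 := by
      nlinarith [sq_nonneg (‖f t‖ - ‖g t‖)]
    have h3 : |t - c| * (2 * (‖f t‖ * ‖g t‖)) ≤ 2 * h * (‖f t‖ ^ 2 + ‖g t‖ ^ 2) :=
      mul_le_mul hc h2 (by positivity) ((abs_nonneg _).trans hc)
    nlinarith
  have e1 := intervalIntegral.integral_eq_sub_of_hasDerivAt (a := -h) (b := s)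
    (fun t _ => hder (-h) t) ((hcont _).intervalIntegrable _ _)
  have e2 := intervalIntegral.integral_eq_sub_of_hasDerivAt (a := s) (b := h)
    (fun t _ => hder h t) ((hcont _).intervalIntegrable _ _)
  have i1 := intervalIntegral.integral_mono_on (μ := volume) hs1 ((hcont (-h)).intervalIntegrable _ _)
    (hcont'.intervalIntegrable _ _) fun t ht => hle (-h) t (by
      rw [abs_le]; constructor <;> linarith [ht.1, ht.2])
  have i2 := intervalIntegral.integral_mono_on (μ := volume) hs2 ((hcont h).intervalIntegrable _ _)
    (hcont'.intervalIntegrable _ _) fun t ht => hle h t (by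
      rw [abs_le]; constructor <;> linarith [ht.1, ht.2])
  rw [← intervalIntegral.integral_add_adjacent_intervals (hcont'.intervalIntegrable (-h) s)
    (hcont'.intervalIntegrable s h)]
  nlinarith

theorem sq_norm_toLp {α : Type*} [MeasurableSpace α] {μ : Measure α} {f : α → ℂ}
    (hf : MemLp f 2 μ) : ‖hf.toLp f‖ ^ 2 = ∫ x, ‖f x‖ ^ 2 ∂μ := by
  rw [← inner_self_eq_norm_sq (𝕜 := ℂ), L2.inner_def, ← integral_re]
  · refine integral_congr_ae (hf.coeFn_toLp.mono fun x hx => ?_)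
    simp only [hx]
    rw [inner_self_eq_norm_sq (𝕜 := ℂ)]
  · exact L2.integrable_inner _ _

/-- The trace inequality for smooth functions. -/
theorem norm_restrictLine_le {s : ℝ} (hs : s ∈ Set.Icc (-S.H) S.H) :
    ∃ C, ∀ φ, ‖S.restrictLine s φ‖ ≤ C * ‖S.ofSmooth φ‖ := by
  have hH := S.H_pos
  refine ⟨√((1 + 2 * S.H) / (2 * S.H)), fun φ => ?_⟩
  refine abs_le_of_sq_le_sq' ?_ (by positivity) |>.2
  rw [mul_pow, Real.sq_sqrt (by positivity), div_mul_eq_mul_div, le_div_iff₀ (by positivity)]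
  set F : ℝ × ℝ → ℂ := (φ : ℝ × ℝ → ℂ)
  set G : ℝ × ℝ → ℂ := fun p => fderiv ℝ (φ : ℝ × ℝ → ℂ) p (0, 1)
  have hF : Continuous F := smoothQP_continuous φ
  have hG : Continuous G := smoothQP_continuous_deriv φ (0, 1)
  have hn : ‖S.ofSmooth φ‖ ^ 2 ≥
      (∫ p, ‖F p‖ ^ 2 ∂S.cellMeasure) + ∫ p, ‖G p‖ ^ 2 ∂S.cellMeasure := by
    have : ‖S.ofSmooth φ‖ ^ 2 = ‖S.jet φ‖ ^ 2 := rfl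
    rw [this, PiLp.norm_sq_eq_of_L2, Fin.sum_univ_three, ← sq_norm_toLp (S.memLp_cell hF 2),
      ← sq_norm_toLp (S.memLp_cell hG 2)]
    have h1 : (S.jet φ) 0 = (S.memLp_cell hF 2).toLp F := rfl
    have h2 : (S.jet φ) 2 = (S.memLp_cell hG 2).toLp G := rfl
    rw [h1, h2]
    nlinarith [sq_nonneg ‖(S.jet φ) 1‖]
  have hr : ‖S.restrictLine s φ‖ ^ 2 = ∫ x, ‖F (x, s)‖ ^ 2 ∂S.lineMeasure :=
    sq_norm_toLp (S.memLp_line (f := fun x => F (x, s)) (hF.comp (by fun_prop)) 2)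
  have hFi : Integrable (fun p => ‖F p‖ ^ 2) S.cellMeasure :=
    (memLp_two_iff_integrable_sq_norm hF.aestronglyMeasurable).1 (S.memLp_cell hF 2)
  have hGi : Integrable (fun p => ‖G p‖ ^ 2) S.cellMeasure :=
    (memLp_two_iff_integrable_sq_norm hG.aestronglyMeasurable).1 (S.memLp_cell hG 2)
  have hprod : S.cellMeasure = S.lineMeasure.prod (volume.restrict (Set.Ioo (-S.H) S.H)) := by
    rw [Measure.prod_restrict]; rfl
  have hI : Integrable (fun p => (1 + 2 * S.H) * ‖F p‖ ^ 2 + 2 * S.H * ‖G p‖ ^ 2) S.cellMeasure :=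
    (hFi.const_mul _).add (hGi.const_mul _)
  have key : 2 * S.H * ∫ x, ‖F (x, s)‖ ^ 2 ∂S.lineMeasure ≤
      ∫ p, ((1 + 2 * S.H) * ‖F p‖ ^ 2 + 2 * S.H * ‖G p‖ ^ 2) ∂S.cellMeasure := by
    rw [← integral_const_mul]
    rw [hprod] at hI ⊢
    rw [integral_prod _ hI]
    refine integral_mono_of_nonneg (.of_forall fun x => by positivity) hI.integral_prod_left
      (.of_forall fun x => ?_)
    have hd : ∀ t, HasDerivAt (fun t => F (x, t)) (G (x, t)) t := fun t => by
      have h1 : HasDerivAt (fun t : ℝ => (x, t)) ((0 : ℝ), (1 : ℝ)) t :=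
        (hasDerivAt_const t x).prodMk (hasDerivAt_id t)
      exact (smoothQP_differentiable φ (x, t)).hasFDerivAt.comp_hasDerivAt t h1
    have := sq_norm_le_integral hd (by fun_prop) hs
    rwa [intervalIntegral.integral_of_le (by linarith), integral_Ioc_eq_integral_Ioo] at this
  rw [integral_add (hFi.const_mul _) (hGi.const_mul _), integral_const_mul,
    integral_const_mul] at key
  have hG0 : 0 ≤ ∫ p, ‖G p‖ ^ 2 ∂S.cellMeasure := integral_nonneg fun p => by positivity
  rw [hr]
  nlinarith

/-- On smooth functions the trace is the restriction. -/
theorem trace_ofSmooth {s : ℝ} (hs : s ∈ Set.Icc (-S.H) S.H) (φ : S.smoothQP) :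
    S.trace s (S.ofSmooth φ) = S.restrictLine s φ :=
  LinearMap.extendOfNorm_eq S.denseRange_ofSmooth (S.norm_restrictLine_le hs) φ

variable {S}

/-- The function underlying an element of `H¹_qp(Ω)`. -/
def val (w : S.H1qp) : S.L2Cell := (w : S.L2Cell3) 0

/-- Its weak derivative in the horizontal variable. -/
def d1 (w : S.H1qp) : S.L2Cell := (w : S.L2Cell3) 1

/-- Its weak derivative in the vertical variable. -/
def d2 (w : S.H1qp) : S.L2Cell := (w : S.L2Cell3) 2

/-- The square of the `H¹(Ω)` seminorm. -/
def seminormSq (w : S.H1qp) : ℝ := ‖d1 w‖ ^ 2 + ‖d2 w‖ ^ 2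

theorem norm_sq_eq (w : S.H1qp) : ‖w‖ ^ 2 = ‖val w‖ ^ 2 + seminormSq w := by
  have : ‖w‖ ^ 2 = ‖(w : S.L2Cell3)‖ ^ 2 := rfl
  rw [this, PiLp.norm_sq_eq_of_L2, Fin.sum_univ_three, add_assoc]
  rfl

/-- The coefficient `wₙ(s)` in the expansion `w (x, s) = ∑ₙ wₙ(s) exp (i αₙ x)` of the trace of `w`
at height `s`. -/
def coeff (s : ℝ) (w : S.H1qp) (n : ℤ) : ℂ :=
  (S.L : ℂ)⁻¹ * ∫ x, S.trace s w x * Complex.exp (-(Complex.I * S.alpha n * x)) ∂S.lineMeasure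

variable (S) in
/-- The vertical wavenumber `βₙ` in a half-space of constant permittivity `e`. -/
def beta (e : ℝ) (n : ℤ) : ℂ :=
  if S.alpha n ^ 2 < S.κ ^ 2 * e then (√(S.κ ^ 2 * e - S.alpha n ^ 2) : ℝ)
  else Complex.I * (√(S.alpha n ^ 2 - S.κ ^ 2 * e) : ℝ)

/-- The coefficient of `exp (i αₙ x)` in `T w = (i / e) ∑ₙ wₙ(s) βₙ exp (i αₙ x)`, where `T` is the
Dirichlet-to-Neumann operator at height `s` for a half-space of constant permittivity `e`. -/
def dtnCoeff (e s : ℝ) (w : S.H1qp) (n : ℤ) : ℂ :=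
  Complex.I / e * (coeff s w n * S.beta e n)

/-- The terms of the series for the boundary integral of `T w` times the conjugate of `v`. -/
def dtnTerm (e s : ℝ) (w v : S.H1qp) (n : ℤ) : ℂ :=
  S.L * (dtnCoeff e s w n * conj (coeff s v n))

/-- The boundary integral of `T w` times the conjugate of `v` over the segment at height `s`. Since
`T w` is in general only a functional on `H^(1/2)` traces, this is the duality pairing; by the
orthogonality of the functions `exp (i αₙ x)` on `(0, L)` it is `L ∑ₙ (T w)ₙ conj vₙ(s)`. -/
def dtnForm (e s : ℝ) (w v : S.H1qp) : ℂ := ∑' n, dtnTerm e s w v n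

/-- The sesquilinear form `B_ε` on `H¹_qp(Ω)`. -/
def form (ε : ℝ × ℝ → ℂ) (w v : S.H1qp) : ℂ :=
  (∫ p, ((ε p)⁻¹ * (d1 w p * conj (d1 v p) + d2 w p * conj (d2 v p))
      - (S.κ : ℂ) ^ 2 * (val w p * conj (val v p))) ∂S.cellMeasure)
    - dtnForm S.epsBot (-S.H) w v - dtnForm S.epsTop S.H w v

/-- Coercivity of a form on a complex normed space. -/
def Coercive {V : Type*} [NormedAddCommGroup V] (B : V → V → ℂ) : Prop :=
  ∃ c : ℝ, 0 < c ∧ ∀ w, c * ‖w‖ ^ 2 ≤ ‖B w w‖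

variable (S) in
/-- `σ(ε) = min_Ω (Re ε / |ε|², 1)`. -/
def sigma (ε : ℝ × ℝ → ℂ) : ℝ :=
  essInf (fun p => min ((ε p).re / ‖ε p‖ ^ 2) 1) S.cellMeasure

variable (S) in
/-- `λ(ε) = c min_Ω (Im ε / |ε|², 1)`. -/
def lam (c : ℝ) (ε : ℝ × ℝ → ℂ) : ℝ :=
  c * essInf (fun p => min ((ε p).im / ‖ε p‖ ^ 2) 1) S.cellMeasure

variable (S) in
/-- `γ = κ² + 1`. -/
def gam : ℝ := S.κ ^ 2 + 1

end Setup

end RCWA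

end

/-! Boundary series. Horizontal Fourier modes `mode` turn `∂₁` into multiplication by `i αₙ`, the
boundary terms cancelling by quasi-periodicity. A one-dimensional trace inequality in `x₂`, applied
to each mode with weight `1 + |αₙ|`, and Bessel's inequality bound `∑ (1 + |αₙ|) |wₙ(s)|²` by the
squared `H¹` norm (`sum_weighted_coeff_le`). Since `|βₙ|` grows at most linearly in `|αₙ|`, the DtN
series converge absolutely.

Poincaré inequality (`exists_poincare_constant`). Let `ζ = exp (i α₀ L)`. If `ζ ≠ 1`, no nonzero
constant is quasi-periodic and `∂₁w` alone controls `w`. If `ζ = 1`, some `αₘ` vanishes, and `wₘ` is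
the horizontal mean. Its value at the top is seen by the boundary term, because `βₘ = κ √ε₊` is real
and positive.

Coercivity (`sigma_div_mul_sq_norm_le`). Every `βₙ` has nonnegative real and imaginary parts, so
both DtN forms have `Re ≤ 0` and `Im ≥ 0` on the diagonal. Hence `Re B ≥ σ |w|₁² - κ² ‖w‖²`, and by
the Poincaré inequality `-Im B ≥ λ ‖w‖²`. The combination `Re B - (γ/λ) Im B` is therefore at least
`σ |w|₁² + ‖w‖² ≥ σ ‖w‖²_{H¹}`, and Cauchy–Schwarz in the plane bounds it by a multiple of `|B|`.

All inequalities on `H¹_qp` are proved for smooth functions and extended by density, both sides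
being continuous. -/

noncomputable section

namespace RCWA.Setup

variable (S : Setup)

/-! ### Trace inequality on an interval -/

/-- The weighted one-dimensional trace inequality behind the `H^(1/2)` regularity of traces. -/
theorem weighted_sq_norm_le_integral {f g : ℝ → ℂ} (hf : ∀ t, HasDerivAt f (g t) t)
    (hg : Continuous g) {h s a : ℝ} (ha : 0 ≤ a) (hs : s ∈ Set.Icc (-h) h) :
    2 * h * (a * ‖f s‖ ^ 2) ≤
      ∫ t in (-h)..h, ((a + 2 * h * a ^ 2) * ‖f t‖ ^ 2 + 2 * h * ‖g t‖ ^ 2) := by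
  obtain ⟨hs1, hs2⟩ := hs
  have hfc : Continuous f := continuous_iff_continuousAt.2 fun t => (hf t).continuousAt
  -- Used with `c = -h` on `[-h, s]` and `c = h` on `[s, h]`: the outer boundary terms vanish, and
  -- those at `s` add up to `2 h a ‖f s‖²`.
  have hder : ∀ c t, HasDerivAt (fun t => (t - c) * (a * ‖f t‖ ^ 2))
      (a * ‖f t‖ ^ 2 + (t - c) * (a * (2 * inner ℝ (f t) (g t)))) t := fun c t => by
    have h1 := ((hasDerivAt_id t).sub_const c).fun_mul ((hf t).norm_sq.const_mul a)
    rw [one_mul] at h1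
    exact h1
  have hcont : ∀ c, Continuous fun t =>
      a * ‖f t‖ ^ 2 + (t - c) * (a * (2 * inner ℝ (f t) (g t))) := fun c => by fun_prop
  have hcont' : Continuous fun t =>
      (a + 2 * h * a ^ 2) * ‖f t‖ ^ 2 + 2 * h * ‖g t‖ ^ 2 := by fun_prop
  have hle : ∀ c t, |t - c| ≤ 2 * h →
      a * ‖f t‖ ^ 2 + (t - c) * (a * (2 * inner ℝ (f t) (g t))) ≤
        (a + 2 * h * a ^ 2) * ‖f t‖ ^ 2 + 2 * h * ‖g t‖ ^ 2 := fun c t hc => by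
    have h1 : (t - c) * (a * (2 * inner ℝ (f t) (g t))) ≤
        |t - c| * (a * (2 * (‖f t‖ * ‖g t‖))) := by
      refine (le_abs_self _).trans ?_
      rw [abs_mul, abs_mul, abs_mul, abs_two, abs_of_nonneg ha]
      gcongr
      exact abs_real_inner_le_norm _ _
    have h2 : a * (2 * (‖f t‖ * ‖g t‖)) ≤ a ^ 2 * ‖f t‖ ^ 2 + ‖g t‖ ^ 2 := by
      nlinarith [sq_nonneg (a * ‖f t‖ - ‖g t‖)]
    have h3 : |t - c| * (a * (2 * (‖f t‖ * ‖g t‖))) ≤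
        2 * h * (a ^ 2 * ‖f t‖ ^ 2 + ‖g t‖ ^ 2) :=
      mul_le_mul hc h2 (by positivity) ((abs_nonneg _).trans hc)
    nlinarith
  have e1 := intervalIntegral.integral_eq_sub_of_hasDerivAt (a := -h) (b := s)
    (fun t _ => hder (-h) t) ((hcont _).intervalIntegrable _ _)
  have e2 := intervalIntegral.integral_eq_sub_of_hasDerivAt (a := s) (b := h)
    (fun t _ => hder h t) ((hcont _).intervalIntegrable _ _)
  have i1 := intervalIntegral.integral_mono_on (μ := volume) hs1
    ((hcont (-h)).intervalIntegrable _ _) (hcont'.intervalIntegrable _ _) fun t ht =>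
      hle (-h) t (by rw [abs_le]; constructor <;> linarith [ht.1, ht.2])
  have i2 := intervalIntegral.integral_mono_on (μ := volume) hs2
    ((hcont h).intervalIntegrable _ _) (hcont'.intervalIntegrable _ _) fun t ht =>
      hle h t (by rw [abs_le]; constructor <;> linarith [ht.1, ht.2])
  rw [← intervalIntegral.integral_add_adjacent_intervals (hcont'.intervalIntegrable (-h) s)
    (hcont'.intervalIntegrable s h)]
  nlinarith

/-! ### Quasi-periodic exponentials and Bessel's inequality -/

/-- The quasi-periodic exponential `exp (i αₙ x)`. -/
def expMode (n : ℤ) (x : ℝ) : ℂ := Complex.exp (Complex.I * S.alpha n * x)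

theorem continuous_expMode (n : ℤ) : Continuous (S.expMode n) := by
  unfold expMode; fun_prop

theorem conj_expMode (n : ℤ) (x : ℝ) :
    conj (S.expMode n x) = Complex.exp (-(Complex.I * S.alpha n * x)) := by
  simp [expMode, ← Complex.exp_conj]

theorem norm_expMode (n : ℤ) (x : ℝ) : ‖S.expMode n x‖ = 1 := by
  have : Complex.I * S.alpha n * x = ((S.alpha n * x : ℝ) : ℂ) * Complex.I := by push_cast; ring
  rw [expMode, this, Complex.norm_exp_ofReal_mul_I]

theorem hasDerivAt_conj_expMode (n : ℤ) (x : ℝ) :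
    HasDerivAt (fun x => conj (S.expMode n x))
      (-(Complex.I * S.alpha n) * conj (S.expMode n x)) x := by
  simp only [conj_expMode]
  have h1 : HasDerivAt (fun x : ℝ => -(Complex.I * S.alpha n * (x : ℂ)))
      (-(Complex.I * S.alpha n)) x := by
    simpa using ((Complex.ofRealCLM.hasDerivAt (x := x)).const_mul (Complex.I * S.alpha n)).fun_neg
  simpa [mul_comm] using h1.cexp

/-- `αₙ - α₀` is an integer multiple of `2π / L`, so every exponential picks up over one period the
same phase as the functions in `smoothQP`. -/
theorem expMode_L (n : ℤ) : S.expMode n S.L = Complex.exp (Complex.I * S.alpha 0 * S.L) := by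
  have hL : (S.L : ℂ) ≠ 0 := by exact_mod_cast S.L_pos.ne'
  have : Complex.I * S.alpha n * S.L =
      Complex.I * S.alpha 0 * S.L + n * (2 * Real.pi * Complex.I) := by
    simp only [alpha]; push_cast; field_simp; ring
  rw [expMode, this, Complex.exp_add, Complex.exp_int_mul_two_pi_mul_I, mul_one]

theorem integral_line (f : ℝ → ℂ) : ∫ x, f x ∂S.lineMeasure = ∫ x in (0 : ℝ)..S.L, f x := by
  rw [intervalIntegral.integral_of_le S.L_pos.le, integral_Ioc_eq_integral_Ioo]

theorem integral_line_real (f : ℝ → ℝ) :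
    ∫ x, f x ∂S.lineMeasure = ∫ x in (0 : ℝ)..S.L, f x := by
  rw [intervalIntegral.integral_of_le S.L_pos.le, integral_Ioc_eq_integral_Ioo]

theorem integral_expMode_mul_conj (n m : ℤ) :
    ∫ x, S.expMode n x * conj (S.expMode m x) ∂S.lineMeasure = if n = m then (S.L : ℂ) else 0 := by
  rw [integral_line]
  split_ifs with h
  · subst h
    simp [Complex.mul_conj, Complex.normSq_eq_norm_sq, norm_expMode]
  · have hL : (S.L : ℂ) ≠ 0 := by exact_mod_cast S.L_pos.ne'
    have hnm : ((n : ℂ) - m) ≠ 0 := sub_ne_zero.2 (by exact_mod_cast h)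
    have hc : ((n : ℂ) - m) * (2 * Real.pi * Complex.I) / S.L ≠ 0 := by
      simp [hL, hnm, Complex.I_ne_zero]
    have he : ∀ x : ℝ, S.expMode n x * conj (S.expMode m x) =
        Complex.exp (((n : ℂ) - m) * (2 * Real.pi * Complex.I) / S.L * x) := fun x => by
      rw [conj_expMode, expMode, ← Complex.exp_add]
      congr 1
      simp only [alpha]; push_cast; field_simp; ring
    simp only [he]
    rw [integral_exp_mul_complex hc]
    have : ((n : ℂ) - m) * (2 * Real.pi * Complex.I) / S.L * S.L =
        ((n - m : ℤ) : ℂ) * (2 * Real.pi * Complex.I) := by push_cast; field_simp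
    rw [this, Complex.exp_int_mul_two_pi_mul_I]
    simp

/-- `exp (i αₙ x)` in `L²(0, L)`. -/
def modeLp (n : ℤ) : Lp ℂ 2 S.lineMeasure := (S.memLp_line (S.continuous_expMode n) 2).toLp _

/-- Presents the Fourier integral as a Hilbert space inner product, which gives both Bessel's
inequality and continuity of the coefficients. -/
theorem inner_modeLp (n : ℤ) (f : Lp ℂ 2 S.lineMeasure) :
    inner ℂ (S.modeLp n) f =
      ∫ x, f x * Complex.exp (-(Complex.I * S.alpha n * x)) ∂S.lineMeasure := by
  rw [L2.inner_def]
  refine integral_congr_ae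
    ((S.memLp_line (S.continuous_expMode n) 2).coeFn_toLp.mono fun x hx => ?_)
  simp only [modeLp, hx, RCLike.inner_apply]
  rw [conj_expMode]

theorem orthonormal_modeLp : Orthonormal ℂ fun n => ((√S.L : ℝ) : ℂ)⁻¹ • S.modeLp n := by
  have hL := S.L_pos
  rw [orthonormal_iff_ite]
  intro n m
  have h := S.inner_modeLp n (S.modeLp m)
  have h2 : ∫ x, S.modeLp m x * Complex.exp (-(Complex.I * S.alpha n * x)) ∂S.lineMeasure =
      ∫ x, S.expMode m x * conj (S.expMode n x) ∂S.lineMeasure :=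
    integral_congr_ae ((S.memLp_line (S.continuous_expMode m) 2).coeFn_toLp.mono fun x hx => by
      simp only [modeLp, hx, conj_expMode])
  rw [inner_smul_left, inner_smul_right, h, h2, integral_expMode_mul_conj]
  have hs : ((√S.L : ℝ) : ℂ) * (√S.L : ℝ) = S.L := by
    rw [← Complex.ofReal_mul, Real.mul_self_sqrt hL.le]
  have hs0 : ((√S.L : ℝ) : ℂ) ≠ 0 := by exact_mod_cast (Real.sqrt_pos.2 hL).ne'
  rcases eq_or_ne n m with rfl | hnm
  · simp only [if_true, map_inv₀, Complex.conj_ofReal, ← hs]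
    field_simp
  · simp [hnm, hnm.symm]

/-- Bessel's inequality on `(0, L)`. -/
theorem sum_sq_norm_inner_modeLp_le (f : Lp ℂ 2 S.lineMeasure) (F : Finset ℤ) :
    ∑ n ∈ F, ‖inner ℂ (S.modeLp n) f‖ ^ 2 ≤ S.L * ‖f‖ ^ 2 := by
  have hL := S.L_pos
  have h := S.orthonormal_modeLp.sum_inner_products_le (x := f) (s := F)
  have he : ∀ n, ‖inner ℂ (((√S.L : ℝ) : ℂ)⁻¹ • S.modeLp n) f‖ ^ 2 =
      S.L⁻¹ * ‖inner ℂ (S.modeLp n) f‖ ^ 2 := fun n => by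
    rw [inner_smul_left, norm_mul, mul_pow]
    simp [Real.sq_sqrt hL.le]
  simp only [he, ← Finset.mul_sum] at h
  rwa [inv_mul_le_iff₀ hL] at h

/-! ### Horizontal Fourier modes of smooth functions -/

/-- The Fourier coefficient `gₙ(t)` of `g (·, t)`. -/
def mode (g : ℝ × ℝ → ℂ) (n : ℤ) (t : ℝ) : ℂ :=
  (S.L : ℂ)⁻¹ * ∫ x in (0 : ℝ)..S.L, g (x, t) * conj (S.expMode n x)

/-- Bessel's inequality on the slice at height `t`; the factor `L` arises because `mode` is
normalized by `1/L` and the orthonormal system by `1/√L`. -/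
theorem sum_sq_norm_mode_le {g : ℝ × ℝ → ℂ} (hg : Continuous g) (t : ℝ) (F : Finset ℤ) :
    S.L * ∑ n ∈ F, ‖S.mode g n t‖ ^ 2 ≤ ∫ x, ‖g (x, t)‖ ^ 2 ∂S.lineMeasure := by
  have hL := S.L_pos
  have hc : Continuous fun x => g (x, t) := by fun_prop
  have h := S.sum_sq_norm_inner_modeLp_le ((S.memLp_line hc 2).toLp _) F
  rw [sq_norm_toLp] at h
  have he : ∀ n, ‖inner ℂ (S.modeLp n) ((S.memLp_line hc 2).toLp _)‖ ^ 2 =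
      S.L ^ 2 * ‖S.mode g n t‖ ^ 2 := fun n => by
    rw [inner_modeLp, mode, ← integral_line, norm_mul, mul_pow]
    have : ∫ x, (S.memLp_line hc 2).toLp _ x * Complex.exp (-(Complex.I * S.alpha n * x))
        ∂S.lineMeasure = ∫ x, g (x, t) * conj (S.expMode n x) ∂S.lineMeasure :=
      integral_congr_ae ((S.memLp_line hc 2).coeFn_toLp.mono fun x hx => by
        simp only [hx, conj_expMode])
    rw [this]
    simp only [norm_inv, Complex.norm_real, Real.norm_eq_abs, inv_pow, sq_abs]
    field_simp
  simp only [he, ← Finset.mul_sum] at h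
  have : S.L * (S.L * ∑ n ∈ F, ‖S.mode g n t‖ ^ 2) ≤
      S.L * ∫ x, ‖g (x, t)‖ ^ 2 ∂S.lineMeasure := by linarith
  exact le_of_mul_le_mul_left this hL

theorem hasDerivAt_snd {φ : ℝ × ℝ → ℂ} (hφ : Differentiable ℝ φ) (x t : ℝ) :
    HasDerivAt (fun t => φ (x, t)) (fderiv ℝ φ (x, t) (0, 1)) t :=
  (hφ (x, t)).hasFDerivAt.comp_hasDerivAt t ((hasDerivAt_const t x).prodMk (hasDerivAt_id t))

theorem hasDerivAt_fst {φ : ℝ × ℝ → ℂ} (hφ : Differentiable ℝ φ) (x t : ℝ) :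
    HasDerivAt (fun x => φ (x, t)) (fderiv ℝ φ (x, t) (1, 0)) x :=
  (hφ (x, t)).hasFDerivAt.comp_hasDerivAt x ((hasDerivAt_id x).prodMk (hasDerivAt_const x t))

theorem continuous_mode {g : ℝ × ℝ → ℂ} (hg : Continuous g) (n : ℤ) : Continuous (S.mode g n) := by
  unfold mode
  refine continuous_const.mul (intervalIntegral.continuous_parametric_intervalIntegral_of_continuous'
    ?_ _ _)
  have := S.continuous_expMode n
  fun_prop

variable {S}

theorem hasDerivAt_mode (φ : S.smoothQP) (n : ℤ) (t : ℝ) :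
    HasDerivAt (S.mode φ n) (S.mode (fun p => fderiv ℝ (φ : ℝ × ℝ → ℂ) p (0, 1)) n t) t := by
  have he := S.continuous_expMode n
  have hφ := smoothQP_continuous φ
  have hd := smoothQP_continuous_deriv φ (0, 1)
  -- Compactness of `[0, L]` times a closed ball around `t` gives the constant dominating function
  -- for differentiation under the integral.
  obtain ⟨K, hK⟩ := (isCompact_Icc (a := (0 : ℝ)) (b := S.L)).prod
    (isCompact_closedBall t 1) |>.exists_bound_of_continuousOn
      (f := fun p => fderiv ℝ (φ : ℝ × ℝ → ℂ) p (0, 1)) hd.continuousOn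
  refine HasDerivAt.const_mul _ (intervalIntegral.hasDerivAt_integral_of_dominated_loc_of_deriv_le
    (s := Metric.ball t 1) (bound := fun _ => K) (Metric.ball_mem_nhds t one_pos)
    (F' := fun s x => fderiv ℝ (φ : ℝ × ℝ → ℂ) (x, s) (0, 1) * conj (S.expMode n x))
    (.of_forall fun s => ?_) ?_ ?_ (.of_forall fun x hx s hs => ?_) (by simp)
    (.of_forall fun x hx s hs => ?_)).2
  · exact Continuous.aestronglyMeasurable (by fun_prop)
  · exact Continuous.intervalIntegrable (by fun_prop) _ _
  · exact Continuous.aestronglyMeasurable (by fun_prop)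
  · rw [norm_mul, RCLike.norm_conj, norm_expMode, mul_one]
    rw [Set.uIoc_of_le S.L_pos.le] at hx
    exact hK (x, s) ⟨⟨hx.1.le, hx.2⟩, Metric.ball_subset_closedBall hs⟩
  · exact (hasDerivAt_snd (smoothQP_differentiable φ) x s).mul_const _

/-- Quasi-periodicity removes the boundary terms in the integration by parts. -/
theorem mode_fderiv_fst (φ : S.smoothQP) (n : ℤ) (t : ℝ) :
    S.mode (fun p => fderiv ℝ (φ : ℝ × ℝ → ℂ) p (1, 0)) n t =
      Complex.I * S.alpha n * S.mode φ n t := by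
  have he := S.continuous_expMode n
  have hφ := smoothQP_continuous φ
  have hd := smoothQP_continuous_deriv φ (1, 0)
  have h := intervalIntegral.integral_mul_deriv_eq_deriv_mul (a := 0) (b := S.L)
    (u := fun x => conj (S.expMode n x)) (v := fun x => (φ : ℝ × ℝ → ℂ) (x, t))
    (fun x _ => S.hasDerivAt_conj_expMode n x)
    (fun x _ => hasDerivAt_fst (smoothQP_differentiable φ) x t)
    (Continuous.intervalIntegrable (by fun_prop) _ _)
    (Continuous.intervalIntegrable (by fun_prop) _ _)
  -- `φ` and the exponential gain the same unimodular factor over a period, and conjugation cancels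
  -- it.
  have hb : conj (S.expMode n S.L) * (φ : ℝ × ℝ → ℂ) (S.L, t) =
      conj (S.expMode n 0) * (φ : ℝ × ℝ → ℂ) (0, t) := by
    have h1 := φ.2.2 0 t
    rw [zero_add, ← S.expMode_L n] at h1
    rw [h1, ← mul_assoc, mul_comm (conj _), Complex.mul_conj, Complex.normSq_eq_norm_sq,
      norm_expMode]
    simp [expMode]
  rw [hb, sub_self, zero_sub] at h
  simp only [mode]
  have e1 : ∀ x, fderiv ℝ (φ : ℝ × ℝ → ℂ) (x, t) (1, 0) * conj (S.expMode n x) =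
      conj (S.expMode n x) * fderiv ℝ (φ : ℝ × ℝ → ℂ) (x, t) (1, 0) := fun x => mul_comm _ _
  simp only [e1]
  rw [h]
  simp only [mul_assoc, neg_mul, intervalIntegral.integral_neg, neg_neg,
    intervalIntegral.integral_const_mul]
  have e2 : ∀ x, conj (S.expMode n x) * (φ : ℝ × ℝ → ℂ) (x, t) =
      (φ : ℝ × ℝ → ℂ) (x, t) * conj (S.expMode n x) := fun x => mul_comm _ _
  simp only [e2]
  ring

/-! ### The `H^(1/2)` trace bound and convergence of the DtN series -/

theorem coeff_eq_inner (s : ℝ) (w : S.H1qp) (n : ℤ) :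
    coeff s w n = (S.L : ℂ)⁻¹ * inner ℂ (S.modeLp n) (S.trace s w) := by
  rw [inner_modeLp]; rfl

theorem continuous_coeff (s : ℝ) (n : ℤ) : Continuous fun w : S.H1qp => coeff s w n := by
  simp only [coeff_eq_inner]
  fun_prop

theorem coeff_ofSmooth {s : ℝ} (hs : s ∈ Set.Icc (-S.H) S.H) (φ : S.smoothQP) (n : ℤ) :
    coeff s (S.ofSmooth φ) n = S.mode φ n s := by
  have hc : Continuous fun x => (φ : ℝ × ℝ → ℂ) (x, s) := by
    have := smoothQP_continuous φ
    fun_prop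
  rw [coeff, S.trace_ofSmooth hs, mode, ← integral_line]
  congr 1
  refine integral_congr_ae ((S.memLp_line hc 2).coeFn_toLp.mono fun x hx => ?_)
  simp only [conj_expMode]
  exact congrArg (· * _) hx

theorem cellMeasure_eq_prod :
    S.cellMeasure = S.lineMeasure.prod (volume.restrict (Set.Ioo (-S.H) S.H)) := by
  rw [Measure.prod_restrict]; rfl

theorem integrable_sq_norm {g : ℝ × ℝ → ℂ} (hg : Continuous g) :
    Integrable (fun p => ‖g p‖ ^ 2) S.cellMeasure :=
  (memLp_two_iff_integrable_sq_norm hg.aestronglyMeasurable).1 (S.memLp_cell hg 2)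

/-- Slicewise Bessel, integrated in `t` by Fubini. With a finite `F`, exchanging sum and integral
raises no convergence question. -/
theorem sum_integral_sq_norm_mode_le {g : ℝ × ℝ → ℂ} (hg : Continuous g) (F : Finset ℤ) :
    S.L * ∑ n ∈ F, ∫ t in (-S.H)..S.H, ‖S.mode g n t‖ ^ 2 ≤ ∫ p, ‖g p‖ ^ 2 ∂S.cellMeasure := by
  have hi := integrable_sq_norm (S := S) hg
  have hc : ∀ n, Continuous fun t => ‖S.mode g n t‖ ^ 2 := fun n =>
    (S.continuous_mode hg n).norm.pow 2
  rw [cellMeasure_eq_prod] at hi ⊢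
  rw [integral_prod_symm _ hi, ← intervalIntegral.integral_finsetSum
    fun n _ => Continuous.intervalIntegrable (hc n) _ _,
    ← intervalIntegral.integral_const_mul,
    intervalIntegral.integral_of_le (by linarith [S.H_pos]), integral_Ioc_eq_integral_Ioo]
  exact integral_mono_of_nonneg (.of_forall fun t => mul_nonneg S.L_pos.le (by positivity))
    hi.integral_prod_right (.of_forall fun t => S.sum_sq_norm_mode_le hg t F)

theorem norm_ofSmooth_sq (φ : S.smoothQP) :
    ‖S.ofSmooth φ‖ ^ 2 = ∫ p, ‖(φ : ℝ × ℝ → ℂ) p‖ ^ 2 ∂S.cellMeasure +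
      ((∫ p, ‖fderiv ℝ (φ : ℝ × ℝ → ℂ) p (1, 0)‖ ^ 2 ∂S.cellMeasure) +
      ∫ p, ‖fderiv ℝ (φ : ℝ × ℝ → ℂ) p (0, 1)‖ ^ 2 ∂S.cellMeasure) := by
  rw [norm_sq_eq, seminormSq, ← sq_norm_toLp (S.memLp_cell (smoothQP_continuous φ) 2),
    ← sq_norm_toLp (S.memLp_cell (smoothQP_continuous_deriv φ (1, 0)) 2),
    ← sq_norm_toLp (S.memLp_cell (smoothQP_continuous_deriv φ (0, 1)) 2)]
  rfl

/-- The `H^(1/2)` trace inequality for smooth functions. -/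
theorem sum_weighted_mode_le {s : ℝ} (hs : s ∈ Set.Icc (-S.H) S.H) (φ : S.smoothQP)
    (F : Finset ℤ) :
    2 * S.H * S.L * ∑ n ∈ F, (1 + |S.alpha n|) * ‖S.mode φ n s‖ ^ 2 ≤
      (2 + 4 * S.H) * ‖S.ofSmooth φ‖ ^ 2 := by
  have hH := S.H_pos
  have hL := S.L_pos
  set D1 : ℝ × ℝ → ℂ := fun p => fderiv ℝ (φ : ℝ × ℝ → ℂ) p (1, 0) with hD1
  set D2 : ℝ × ℝ → ℂ := fun p => fderiv ℝ (φ : ℝ × ℝ → ℂ) p (0, 1) with hD2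
  have c0 := smoothQP_continuous φ
  have c1 : Continuous D1 := smoothQP_continuous_deriv φ (1, 0)
  have c2 : Continuous D2 := smoothQP_continuous_deriv φ (0, 1)
  have hterm : ∀ n, 2 * S.H * ((1 + |S.alpha n|) * ‖S.mode φ n s‖ ^ 2) ≤
      (2 + 4 * S.H) * ((∫ t in (-S.H)..S.H, ‖S.mode φ n t‖ ^ 2) +
        ((∫ t in (-S.H)..S.H, ‖S.mode D1 n t‖ ^ 2) +
          ∫ t in (-S.H)..S.H, ‖S.mode D2 n t‖ ^ 2)) := fun n => by
    have m0 := S.continuous_mode c0 n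
    have m1 := S.continuous_mode c1 n
    have m2 := S.continuous_mode c2 n
    refine (weighted_sq_norm_le_integral (hasDerivAt_mode φ n) m2
      (by positivity : 0 ≤ 1 + |S.alpha n|) hs).trans ?_
    rw [← intervalIntegral.integral_add, ← intervalIntegral.integral_add,
      ← intervalIntegral.integral_const_mul]
    · refine intervalIntegral.integral_mono_on (by linarith) ?_ ?_ fun t _ => ?_
      · exact Continuous.intervalIntegrable (by fun_prop) _ _
      · exact Continuous.intervalIntegrable (by fun_prop) _ _
      -- The squared weight in the trace inequality is paid for by `∂₁φ`, whose modes are `i αₙ`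
      -- times those of `φ`.
      · have hm : ‖S.mode D1 n t‖ ^ 2 = |S.alpha n| ^ 2 * ‖S.mode φ n t‖ ^ 2 := by
          rw [hD1, mode_fderiv_fst]
          simp [mul_pow]
        rw [hm]
        set a := |S.alpha n|
        have ha : 0 ≤ a := abs_nonneg _
        -- Both `1 + a` and `(1 + a)²` are at most `2 (1 + a²)`; this is the source of `2 + 4H`.
        have h1 : (1 + a) + 2 * S.H * (1 + a) ^ 2 ≤ (2 + 4 * S.H) * (1 + a ^ 2) := by
          nlinarith [sq_nonneg (a - 1), mul_nonneg hH.le (sq_nonneg (a - 1))]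
        have h2 := mul_le_mul_of_nonneg_right h1 (sq_nonneg ‖S.mode φ n t‖)
        have h3 : 0 ≤ (2 + 2 * S.H) * ‖S.mode D2 n t‖ ^ 2 := by positivity
        linarith
    all_goals exact Continuous.intervalIntegrable (by fun_prop) _ _
  have h0 := sum_integral_sq_norm_mode_le (S := S) c0 F
  have h1 := sum_integral_sq_norm_mode_le (S := S) c1 F
  have h2 := sum_integral_sq_norm_mode_le (S := S) c2 F
  have hsum := Finset.sum_le_sum fun n (_ : n ∈ F) => hterm n
  rw [← Finset.mul_sum, ← Finset.mul_sum, Finset.sum_add_distrib, Finset.sum_add_distrib] at hsum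
  rw [norm_ofSmooth_sq]
  have := mul_le_mul_of_nonneg_left hsum hL.le
  have h3 := mul_le_mul_of_nonneg_left (add_le_add h0 (add_le_add h1 h2))
    (by positivity : 0 ≤ 2 + 4 * S.H)
  linarith

/-- The `H^(1/2)` trace inequality. -/
theorem sum_weighted_coeff_le {s : ℝ} (hs : s ∈ Set.Icc (-S.H) S.H) (w : S.H1qp)
    (F : Finset ℤ) :
    2 * S.H * S.L * ∑ n ∈ F, (1 + |S.alpha n|) * ‖coeff s w n‖ ^ 2 ≤
      (2 + 4 * S.H) * ‖w‖ ^ 2 := by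
  have hc := continuous_coeff (S := S) s
  refine S.denseRange_ofSmooth.induction_on w (isClosed_le (by fun_prop) (by fun_prop)) fun φ => ?_
  simp only [coeff_ofSmooth hs]
  exact sum_weighted_mode_le hs φ F

theorem summable_weighted_coeff {s : ℝ} (hs : s ∈ Set.Icc (-S.H) S.H) (w : S.H1qp) :
    Summable fun n => (1 + |S.alpha n|) * ‖coeff s w n‖ ^ 2 := by
  have hH := S.H_pos
  have hL := S.L_pos
  refine summable_of_sum_le (c := (2 + 4 * S.H) * ‖w‖ ^ 2 / (2 * S.H * S.L))
    (fun n => by positivity) fun F => ?_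
  rw [le_div_iff₀' (by positivity)]
  exact sum_weighted_coeff_le hs w F

/-- The growth of `βₙ` is matched exactly by the weight `1 + |αₙ|` of the trace bound. -/
theorem norm_beta_le {e : ℝ} (he : 0 < e) (n : ℤ) :
    ‖S.beta e n‖ ≤ (1 + S.κ * √e) * (1 + |S.alpha n|) := by
  have hk := S.κ_pos
  have hq : S.κ ^ 2 * e = (S.κ * √e) ^ 2 := by rw [mul_pow, Real.sq_sqrt he.le]
  have h0 : 0 ≤ S.κ * √e := by positivity
  have ha := abs_nonneg (S.alpha n)
  rw [beta, hq, ← sq_abs (S.alpha n)]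
  split_ifs with h
  · rw [Complex.norm_real, Real.norm_eq_abs, abs_of_nonneg (Real.sqrt_nonneg _)]
    refine Real.sqrt_le_iff.2 ⟨by positivity, ?_⟩
    nlinarith [mul_nonneg h0 ha]
  · rw [norm_mul, Complex.norm_I, one_mul, Complex.norm_real, Real.norm_eq_abs,
      abs_of_nonneg (Real.sqrt_nonneg _)]
    refine Real.sqrt_le_iff.2 ⟨by positivity, ?_⟩
    nlinarith [mul_nonneg h0 ha]

/-- The series for the boundary integrals converge. -/
theorem summable_dtnTerm {e s : ℝ} (he : 0 < e) (hs : s ∈ Set.Icc (-S.H) S.H) (w v : S.H1qp) :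
    Summable (dtnTerm e s w v) := by
  have hL := S.L_pos
  have hk := S.κ_pos
  refine Summable.of_norm_bounded
    (((summable_weighted_coeff hs w).add (summable_weighted_coeff hs v)).mul_left
      (S.L * (1 / e) * (1 + S.κ * √e))) fun n => ?_
  have hn : ‖dtnTerm e s w v n‖ =
      S.L * (1 / e) * (‖S.beta e n‖ * (‖coeff s w n‖ * ‖coeff s v n‖)) := by
    simp only [dtnTerm, dtnCoeff, norm_mul, norm_div, Complex.norm_I, Complex.norm_real,
      RCLike.norm_conj, Real.norm_eq_abs, abs_of_pos hL, abs_of_pos he]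
    ring
  rw [hn, mul_assoc (S.L * (1 / e))]
  refine mul_le_mul_of_nonneg_left ?_ (by positivity)
  rw [← mul_add, ← mul_assoc (1 + S.κ * √e)]
  refine mul_le_mul (norm_beta_le he n) ?_ (by positivity) (by positivity)
  nlinarith [sq_nonneg (‖coeff s w n‖ - ‖coeff s v n‖), sq_nonneg ‖coeff s w n‖,
    sq_nonneg ‖coeff s v n‖]

/-! ### Poincaré inequalities -/

/-- Cauchy–Schwarz against a constant, obtained from the nonnegativity of the variance of `g`. -/
theorem sq_integral_le {g : ℝ → ℝ} (hg : Continuous g) {a b : ℝ} (hab : a < b) :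
    (∫ x in a..b, g x) ^ 2 ≤ (b - a) * ∫ x in a..b, g x ^ 2 := by
  set m := ∫ x in a..b, g x with hm
  have hb : 0 < b - a := sub_pos.2 hab
  have h0 : 0 ≤ ∫ x in a..b, ((b - a) * g x - m) ^ 2 :=
    intervalIntegral.integral_nonneg hab.le fun x _ => sq_nonneg _
  have h1 : ∫ x in a..b, ((b - a) * g x - m) ^ 2 =
      (b - a) ^ 2 * (∫ x in a..b, g x ^ 2) - 2 * (b - a) * m * m + (b - a) * m ^ 2 := by
    have e : ∀ x, ((b - a) * g x - m) ^ 2 =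
        (b - a) ^ 2 * g x ^ 2 - 2 * (b - a) * m * g x + m ^ 2 := fun x => by ring
    simp only [e]
    rw [intervalIntegral.integral_add, intervalIntegral.integral_sub,
      intervalIntegral.integral_const_mul, intervalIntegral.integral_const_mul,
      intervalIntegral.integral_const, smul_eq_mul, ← hm]
    all_goals exact Continuous.intervalIntegrable (by fun_prop) _ _
  rw [h1] at h0
  have h2 : (b - a) * m ^ 2 ≤ (b - a) * ((b - a) * ∫ x in a..b, g x ^ 2) := by nlinarith
  exact le_of_mul_le_mul_left h2 hb

theorem norm_sub_le_integral {f g : ℝ → ℂ} (hf : ∀ t, HasDerivAt f (g t) t) (hg : Continuous g)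
    {a b x y : ℝ} (hx : x ∈ Set.Icc a b) (hy : y ∈ Set.Icc a b) :
    ‖f x - f y‖ ≤ ∫ t in a..b, ‖g t‖ := by
  wlog hxy : y ≤ x generalizing x y
  · rw [norm_sub_rev]
    exact this hy hx (le_of_not_ge hxy)
  rw [← intervalIntegral.integral_eq_sub_of_hasDerivAt (fun t _ => hf t)
    (hg.intervalIntegrable _ _)]
  refine (intervalIntegral.norm_integral_le_integral_norm hxy).trans ?_
  exact intervalIntegral.integral_mono_interval hy.1 hxy hx.2 (.of_forall fun t => norm_nonneg _)
    (hg.norm.intervalIntegrable _ _)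

/-- The values of a function that is quasi-periodic but not periodic are controlled by its
derivative. -/
theorem norm_le_integral_of_ne_one {f g : ℝ → ℂ} (hf : ∀ t, HasDerivAt f (g t) t)
    (hg : Continuous g) {L x : ℝ} {ζ : ℂ} (hζ : ζ ≠ 1) (hper : f L = ζ * f 0)
    (hx : x ∈ Set.Icc 0 L) : ‖f x‖ ≤ (‖ζ - 1‖⁻¹ + 1) * ∫ t in (0 : ℝ)..L, ‖g t‖ := by
  have hL : 0 ≤ L := hx.1.trans hx.2
  have h1 := norm_sub_le_integral hf hg (Set.right_mem_Icc.2 hL) (Set.left_mem_Icc.2 hL)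
  have h2 := norm_sub_le_integral hf hg hx (Set.left_mem_Icc.2 hL)
  have hpos : 0 < ‖ζ - 1‖ := norm_pos_iff.2 (sub_ne_zero.2 hζ)
  -- The increment over a period determines `f 0`, because `ζ - 1` is invertible.
  have h3 : f L - f 0 = (ζ - 1) * f 0 := by rw [hper]; ring
  rw [h3, norm_mul, ← le_inv_mul_iff₀ hpos] at h1
  have h4 := norm_le_norm_sub_add (f x) (f 0)
  linarith

/-- A function differs from its mean by at most the integral of its derivative. -/
theorem norm_sub_mean_le {f g : ℝ → ℂ} (hf : ∀ t, HasDerivAt f (g t) t) (hg : Continuous g)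
    {L x : ℝ} (hL : 0 < L) (hx : x ∈ Set.Icc 0 L) :
    ‖f x - (L : ℂ)⁻¹ * ∫ y in (0 : ℝ)..L, f y‖ ≤ ∫ t in (0 : ℝ)..L, ‖g t‖ := by
  have hfc : Continuous f := continuous_iff_continuousAt.2 fun t => (hf t).continuousAt
  have hLc : (L : ℂ) ≠ 0 := by exact_mod_cast hL.ne'
  have h1 : f x - (L : ℂ)⁻¹ * ∫ y in (0 : ℝ)..L, f y =
      (L : ℂ)⁻¹ * ∫ y in (0 : ℝ)..L, (f x - f y) := by
    rw [intervalIntegral.integral_sub (by simp) (hfc.intervalIntegrable _ _),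
      intervalIntegral.integral_const, sub_zero, Complex.real_smul]
    field_simp
  have h2 : ‖∫ y in (0 : ℝ)..L, (f x - f y)‖ ≤ (∫ t in (0 : ℝ)..L, ‖g t‖) * |L - 0| := by
    refine intervalIntegral.norm_integral_le_of_norm_le_const fun y hy => ?_
    rw [Set.uIoc_of_le hL.le] at hy
    exact norm_sub_le_integral hf hg hx ⟨hy.1.le, hy.2⟩
  rw [sub_zero, abs_of_pos hL] at h2
  rw [h1, norm_mul, norm_inv, Complex.norm_real, Real.norm_eq_abs, abs_of_pos hL,
    inv_mul_le_iff₀ hL]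
  linarith

/-- Integration over the cell of a bound on horizontal sections. -/
theorem integral_cell_le_of_section_le {φ g : ℝ × ℝ → ℂ} (hφ : Continuous φ) (hg : Continuous g)
    {a b : ℝ} (h : ∀ x ∈ Set.Icc 0 S.L, ∀ t,
      t ∈ Set.Icc (-S.H) S.H → ‖φ (x, t)‖ ^ 2 ≤ a * (∫ y in (0 : ℝ)..S.L, ‖g (y, t)‖ ^ 2) + b) :
    ∫ p, ‖φ p‖ ^ 2 ∂S.cellMeasure ≤
      S.L * a * (∫ p, ‖g p‖ ^ 2 ∂S.cellMeasure) + 2 * S.H * S.L * b := by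
  have hL := S.L_pos
  have hH := S.H_pos
  have hi := integrable_sq_norm (S := S) hφ
  have hj := integrable_sq_norm (S := S) hg
  rw [cellMeasure_eq_prod] at hi hj ⊢
  rw [integral_prod_symm _ hi, integral_prod_symm _ hj]
  have hsec : ∀ t ∈ Set.Icc (-S.H) S.H, ∫ x, ‖φ (x, t)‖ ^ 2 ∂S.lineMeasure ≤
      S.L * a * (∫ x, ‖g (x, t)‖ ^ 2 ∂S.lineMeasure) + S.L * b := fun t ht => by
    rw [integral_line_real, integral_line_real]
    refine (intervalIntegral.integral_mono_on hL.le
      (Continuous.intervalIntegrable (by fun_prop) _ _)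
      (Continuous.intervalIntegrable continuous_const _ _) fun x hx => h x hx t ht).trans ?_
    rw [intervalIntegral.integral_const, smul_eq_mul, sub_zero]
    linarith
  have hb : Integrable (fun _ : ℝ => S.L * b) (volume.restrict (Set.Ioo (-S.H) S.H)) :=
    integrable_const _
  refine (integral_mono_ae hi.integral_prod_right
    ((hj.integral_prod_right.const_mul (S.L * a)).add hb)
    ((ae_restrict_mem measurableSet_Ioo).mono fun t ht =>
      hsec t (Set.Ioo_subset_Icc_self ht))).trans ?_
  simp only [Pi.add_apply]
  rw [integral_add (hj.integral_prod_right.const_mul _) hb, integral_const_mul, integral_const]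
  simp only [MeasurableSet.univ, measureReal_restrict_apply, Set.univ_inter, Real.volume_real_Ioo,
    smul_eq_mul]
  rw [max_eq_left (by linarith)]
  linarith

theorem continuous_val : Continuous (val : S.H1qp → S.L2Cell) := by unfold val; fun_prop

theorem continuous_d1 : Continuous (d1 : S.H1qp → S.L2Cell) := by unfold d1; fun_prop

theorem continuous_d2 : Continuous (d2 : S.H1qp → S.L2Cell) := by unfold d2; fun_prop

theorem val_ofSmooth_sq (φ : S.smoothQP) :
    ‖val (S.ofSmooth φ)‖ ^ 2 = ∫ p, ‖(φ : ℝ × ℝ → ℂ) p‖ ^ 2 ∂S.cellMeasure :=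
  sq_norm_toLp (S.memLp_cell (smoothQP_continuous φ) 2)

theorem d1_ofSmooth_sq (φ : S.smoothQP) : ‖d1 (S.ofSmooth φ)‖ ^ 2 =
    ∫ p, ‖fderiv ℝ (φ : ℝ × ℝ → ℂ) p (1, 0)‖ ^ 2 ∂S.cellMeasure :=
  sq_norm_toLp (S.memLp_cell (smoothQP_continuous_deriv φ (1, 0)) 2)

theorem d2_ofSmooth_sq (φ : S.smoothQP) : ‖d2 (S.ofSmooth φ)‖ ^ 2 =
    ∫ p, ‖fderiv ℝ (φ : ℝ × ℝ → ℂ) p (0, 1)‖ ^ 2 ∂S.cellMeasure :=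
  sq_norm_toLp (S.memLp_cell (smoothQP_continuous_deriv φ (0, 1)) 2)

/-- The Poincaré inequality in the absence of nonzero constants. -/
theorem sq_norm_val_le_of_ne_one (hζ : Complex.exp (Complex.I * S.alpha 0 * S.L) ≠ 1)
    (w : S.H1qp) :
    ‖val w‖ ^ 2 ≤
      (S.L * (‖Complex.exp (Complex.I * S.alpha 0 * S.L) - 1‖⁻¹ + 1)) ^ 2 * ‖d1 w‖ ^ 2 := by
  have hv := continuous_val (S := S)
  have h1 := continuous_d1 (S := S)
  set ζ := Complex.exp (Complex.I * S.alpha 0 * S.L)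
  refine S.denseRange_ofSmooth.induction_on w (isClosed_le (by fun_prop) (by fun_prop)) fun φ => ?_
  have c0 := smoothQP_continuous φ
  have c1 := smoothQP_continuous_deriv φ (1, 0)
  rw [val_ofSmooth_sq, d1_ofSmooth_sq]
  have := integral_cell_le_of_section_le (S := S) (a := (‖ζ - 1‖⁻¹ + 1) ^ 2 * S.L) (b := 0) c0 c1
    fun x hx t _ => by
      have hc : Continuous fun y => fderiv ℝ (φ : ℝ × ℝ → ℂ) (y, t) (1, 0) := by fun_prop
      have hper := φ.2.2 0 t
      rw [zero_add] at hper
      have h2 := norm_le_integral_of_ne_one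
        (fun y => hasDerivAt_fst (smoothQP_differentiable φ) y t) hc hζ hper hx
      have h3 := sq_integral_le hc.norm S.L_pos
      calc ‖(φ : ℝ × ℝ → ℂ) (x, t)‖ ^ 2 ≤ _ := pow_le_pow_left₀ (norm_nonneg _) h2 2
        _ = (‖ζ - 1‖⁻¹ + 1) ^ 2 * _ := mul_pow _ _ 2
        _ ≤ (‖ζ - 1‖⁻¹ + 1) ^ 2 * _ := mul_le_mul_of_nonneg_left h3 (sq_nonneg _)
        _ = _ := by ring
  linarith

/-- The Poincaré inequality in the presence of constants, with control of the mean of the trace at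
the top. -/
theorem sq_norm_val_le_of_alpha_eq_zero {m : ℤ} (hm : S.alpha m = 0) (w : S.H1qp) :
    ‖val w‖ ^ 2 ≤ 3 * S.L ^ 2 * ‖d1 w‖ ^ 2 + 12 * S.H ^ 2 * ‖d2 w‖ ^ 2 +
      6 * S.H * S.L * ‖coeff S.H w m‖ ^ 2 := by
  have hL := S.L_pos
  have hH := S.H_pos
  have hv := continuous_val (S := S)
  have h1 := continuous_d1 (S := S)
  have h2 := continuous_d2 (S := S)
  have h3 := continuous_coeff (S := S) S.H m
  have hHm : S.H ∈ Set.Icc (-S.H) S.H := Set.right_mem_Icc.2 (by linarith)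
  refine S.denseRange_ofSmooth.induction_on w (isClosed_le (by fun_prop) (by fun_prop)) fun φ => ?_
  have c0 := smoothQP_continuous φ
  have c1 := smoothQP_continuous_deriv φ (1, 0)
  have c2 := smoothQP_continuous_deriv φ (0, 1)
  rw [val_ofSmooth_sq, d1_ofSmooth_sq, d2_ofSmooth_sq, coeff_ofSmooth hHm]
  set D2 : ℝ × ℝ → ℂ := fun p => fderiv ℝ (φ : ℝ × ℝ → ℂ) p (0, 1) with hD2
  have m2 := S.continuous_mode c2 m
  have hK := sq_integral_le m2.norm (show -S.H < S.H by linarith)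
  have hK2 := sum_integral_sq_norm_mode_le (S := S) c2 {m}
  rw [Finset.sum_singleton] at hK2
  set K := ∫ t in (-S.H)..S.H, ‖S.mode D2 m t‖
  -- With `αₘ = 0` the exponential is `1`, so the mode is the horizontal mean.
  have hmode : ∀ t, S.mode φ m t = (S.L : ℂ)⁻¹ * ∫ y in (0 : ℝ)..S.L, (φ : ℝ × ℝ → ℂ) (y, t) :=
    fun t => by simp [mode, expMode, hm]
  have := integral_cell_le_of_section_le (S := S) (a := 3 * S.L)
    (b := 3 * K ^ 2 + 3 * ‖S.mode φ m S.H‖ ^ 2) c0 c1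
    fun x hx t ht => by
      have hc : Continuous fun y => fderiv ℝ (φ : ℝ × ℝ → ℂ) (y, t) (1, 0) := by fun_prop
      have h4 := norm_sub_mean_le
        (fun y => hasDerivAt_fst (smoothQP_differentiable φ) y t) hc hL hx
      rw [← hmode] at h4
      have h5 := norm_sub_le_integral (hasDerivAt_mode φ m) m2 ht hHm
      have h6 := sq_integral_le hc.norm hL
      rw [sub_zero] at h6
      -- Deviation from the slice mean, change of the mean between heights `t` and `H`, and mean at
      -- the top; squaring the three-term sum costs the factor `3`.
      have h7 : ‖(φ : ℝ × ℝ → ℂ) (x, t)‖ ≤ ‖(φ : ℝ × ℝ → ℂ) (x, t) - S.mode φ m t‖ +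
          ‖S.mode φ m t - S.mode φ m S.H‖ + ‖S.mode φ m S.H‖ := by
        refine le_trans (le_of_eq ?_) norm_add₃_le
        congr 1; ring
      set J := ∫ y in (0 : ℝ)..S.L, ‖fderiv ℝ (φ : ℝ × ℝ → ℂ) (y, t) (1, 0)‖
      set M := ‖S.mode φ m S.H‖
      have h8 : ‖(φ : ℝ × ℝ → ℂ) (x, t)‖ ≤ J + K + M := by linarith
      have h9 := pow_le_pow_left₀ (norm_nonneg _) h8 2
      nlinarith [sq_nonneg (J - K), sq_nonneg (J - M), sq_nonneg (K - M)]
  have h10 : S.L * K ^ 2 ≤ 2 * S.H * ∫ p, ‖D2 p‖ ^ 2 ∂S.cellMeasure := by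
    have h11 := mul_le_mul_of_nonneg_left hK hL.le
    have h12 := mul_le_mul_of_nonneg_left hK2 (by positivity : 0 ≤ 2 * S.H)
    linarith
  have h13 := mul_le_mul_of_nonneg_left h10 (by positivity : 0 ≤ 6 * S.H)
  linarith

/-! ### Signs of the DtN forms and the Poincaré constant -/

/-- On the diagonal each term is a real multiple of `i βₙ`, nonnegative for `e > 0`. Propagating
modes thus feed only the imaginary part, evanescent modes only the real part. -/
theorem dtnTerm_self (e s : ℝ) (w : S.H1qp) (n : ℤ) :
    dtnTerm e s w w n =
      ((S.L * ‖coeff s w n‖ ^ 2 / e : ℝ) : ℂ) * (Complex.I * S.beta e n) := by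
  have h : coeff s w n * conj (coeff s w n) = ((‖coeff s w n‖ ^ 2 : ℝ) : ℂ) := by
    rw [Complex.mul_conj, Complex.normSq_eq_norm_sq]
  calc dtnTerm e s w w n
      = S.L * (Complex.I / e * S.beta e n) * (coeff s w n * conj (coeff s w n)) := by
        simp only [dtnTerm, dtnCoeff]; ring
    _ = _ := by rw [h]; push_cast; ring

theorem beta_re_nonneg (e : ℝ) (n : ℤ) : 0 ≤ (S.beta e n).re := by
  unfold beta; split_ifs <;> simp

theorem beta_im_nonneg (e : ℝ) (n : ℤ) : 0 ≤ (S.beta e n).im := by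
  unfold beta; split_ifs <;> simp

theorem dtnTerm_self_im {e : ℝ} (s : ℝ) (w : S.H1qp) (n : ℤ) :
    (dtnTerm e s w w n).im = S.L * ‖coeff s w n‖ ^ 2 / e * (S.beta e n).re := by
  rw [dtnTerm_self, Complex.im_ofReal_mul]
  simp

theorem dtnTerm_self_re {e : ℝ} (s : ℝ) (w : S.H1qp) (n : ℤ) :
    (dtnTerm e s w w n).re = -(S.L * ‖coeff s w n‖ ^ 2 / e * (S.beta e n).im) := by
  rw [dtnTerm_self, Complex.re_ofReal_mul]
  simp

theorem dtnTerm_self_im_nonneg {e : ℝ} (he : 0 < e) (s : ℝ) (w : S.H1qp) (n : ℤ) :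
    0 ≤ (dtnTerm e s w w n).im := by
  have := S.L_pos
  rw [dtnTerm_self_im]
  exact mul_nonneg (by positivity) (beta_re_nonneg e n)

theorem dtnForm_self_im {e s : ℝ} (he : 0 < e) (hs : s ∈ Set.Icc (-S.H) S.H) (w : S.H1qp) :
    (dtnForm e s w w).im = ∑' n, (dtnTerm e s w w n).im :=
  Complex.im_tsum (summable_dtnTerm he hs w w)

/-- A single term of a nonnegative series is at most the sum; this isolates the mode with `αₘ = 0`.
-/
theorem dtnTerm_self_im_le {e s : ℝ} (he : 0 < e) (hs : s ∈ Set.Icc (-S.H) S.H) (w : S.H1qp)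
    (n : ℤ) : (dtnTerm e s w w n).im ≤ (dtnForm e s w w).im := by
  rw [dtnForm_self_im he hs]
  exact (Complex.imCLM.summable (summable_dtnTerm he hs w w)).le_tsum n
    fun k _ => dtnTerm_self_im_nonneg he s w k

theorem dtnForm_self_im_nonneg {e s : ℝ} (he : 0 < e) (hs : s ∈ Set.Icc (-S.H) S.H)
    (w : S.H1qp) : 0 ≤ (dtnForm e s w w).im :=
  (dtnTerm_self_im_nonneg he s w 0).trans (dtnTerm_self_im_le he hs w 0)

theorem dtnForm_self_re_nonpos {e s : ℝ} (he : 0 < e) (hs : s ∈ Set.Icc (-S.H) S.H)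
    (w : S.H1qp) : (dtnForm e s w w).re ≤ 0 := by
  have hL := S.L_pos
  rw [dtnForm, Complex.re_tsum (summable_dtnTerm he hs w w)]
  refine tsum_nonpos fun n => ?_
  rw [dtnTerm_self_re, neg_nonpos]
  exact mul_nonneg (by positivity) (beta_im_nonneg e n)

theorem exists_alpha_eq_zero (hζ : Complex.exp (Complex.I * S.alpha 0 * S.L) = 1) :
    ∃ m, S.alpha m = 0 := by
  obtain ⟨k, hk⟩ := Complex.exp_eq_one_iff.1 hζ
  refine ⟨-k, ?_⟩
  have hL := S.L_pos
  have h : S.alpha 0 * S.L = k * (2 * Real.pi) := by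
    have h1 : ((S.alpha 0 * S.L : ℝ) : ℂ) = ((k * (2 * Real.pi) : ℝ) : ℂ) := by
      refine mul_left_cancel₀ Complex.I_ne_zero ?_
      push_cast
      linear_combination hk
    exact_mod_cast h1
  have h2 : S.alpha (-k) * S.L = 0 := by
    have : S.alpha (-k) * S.L = S.alpha 0 * S.L - k * (2 * Real.pi) := by
      simp only [alpha]; push_cast; field_simp; ring
    rw [this, h, sub_self]
  exact (mul_eq_zero.1 h2).resolve_right hL.ne'

variable (S) in
/-- The Poincaré inequality with the propagating modes at the top as boundary term. -/
theorem exists_poincare_constant : ∃ C : ℝ, 0 < C ∧ ∀ w : S.H1qp,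
    ‖val w‖ ^ 2 ≤ C * (seminormSq w + (dtnForm S.epsTop S.H w w).im) := by
  have hL := S.L_pos
  have hH := S.H_pos
  have hk := S.κ_pos
  have he := S.epsTop_pos
  have hHm : S.H ∈ Set.Icc (-S.H) S.H := Set.right_mem_Icc.2 (by linarith)
  by_cases hζ : Complex.exp (Complex.I * S.alpha 0 * S.L) = 1
  · obtain ⟨m, hm⟩ := exists_alpha_eq_zero hζ
    -- The sum of three constants: those of `d1` and `d2`, and the one converting `6 H L |wₘ(H)|²`
    -- into `Im` of the DtN form via `βₘ = κ √ε₊`.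
    refine ⟨3 * S.L ^ 2 + 12 * S.H ^ 2 + 6 * S.H * S.epsTop / (S.κ * √S.epsTop), by positivity,
      fun w => (sq_norm_val_le_of_alpha_eq_zero hm w).trans ?_⟩
    have hβ : (S.beta S.epsTop m).re = S.κ * √S.epsTop := by
      have : 0 < S.κ ^ 2 * S.epsTop := by positivity
      rw [beta, hm, if_pos (by simpa using this), Complex.ofReal_re, zero_pow two_ne_zero, sub_zero,
        Real.sqrt_mul (sq_nonneg _), Real.sqrt_sq hk.le]
    have hle := dtnTerm_self_im_le he hHm w m
    have h0 := dtnForm_self_im_nonneg he hHm w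
    rw [dtnTerm_self_im, hβ] at hle
    set D := (dtnForm S.epsTop S.H w w).im
    have hs := Real.sqrt_pos.2 he
    have h1 : 6 * S.H * S.L * ‖coeff S.H w m‖ ^ 2 ≤
        6 * S.H * S.epsTop / (S.κ * √S.epsTop) * D := by
      refine le_trans (le_of_eq ?_) (mul_le_mul_of_nonneg_left hle (by positivity))
      field_simp
    set q := 6 * S.H * S.epsTop / (S.κ * √S.epsTop)
    have hq : 0 ≤ q := by positivity
    rw [seminormSq]
    have p1 : 0 ≤ (12 * S.H ^ 2 + q) * ‖d1 w‖ ^ 2 := by positivity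
    have p2 : 0 ≤ (3 * S.L ^ 2 + q) * ‖d2 w‖ ^ 2 := by positivity
    have p3 : 0 ≤ (3 * S.L ^ 2 + 12 * S.H ^ 2) * D := by positivity
    linarith
  · refine ⟨(S.L * (‖Complex.exp (Complex.I * S.alpha 0 * S.L) - 1‖⁻¹ + 1)) ^ 2, by positivity,
      fun w => (sq_norm_val_le_of_ne_one hζ w).trans (mul_le_mul_of_nonneg_left ?_ (sq_nonneg _))⟩
    have h0 := dtnForm_self_im_nonneg he hHm w
    rw [seminormSq]
    linarith [sq_nonneg ‖d2 w‖]

/-! ### Essential infima -/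

theorem cellMeasure_ne_zero : S.cellMeasure ≠ 0 := by
  have hL := S.L_pos
  have hH := S.H_pos
  rw [Ne, Measure.restrict_eq_zero, cell, Measure.volume_eq_prod, Measure.prod_prod]
  simp [hL, hH]

/-- An essential infimum in `ℝ` is meaningful only with bounds on both sides: `c` supplies the lower
one, truncation at `1` the upper one, and the cell must have positive measure. -/
theorem pos_le_essInf_min_one {f : ℝ × ℝ → ℝ} {c : ℝ} (hc : 0 < c)
    (hf : ∀ᵐ p ∂S.cellMeasure, c ≤ f p) :
    0 < essInf (fun p => min (f p) 1) S.cellMeasure ∧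
      essInf (fun p => min (f p) 1) S.cellMeasure ≤ 1 ∧
      ∀ᵐ p ∂S.cellMeasure, essInf (fun p => min (f p) 1) S.cellMeasure ≤ f p := by
  have : (ae S.cellMeasure).NeBot := ae_neBot.2 cellMeasure_ne_zero
  have hlow : ∀ᵐ p ∂S.cellMeasure, min c 1 ≤ min (f p) 1 :=
    hf.mono fun p hp => min_le_min_right 1 hp
  have hb : Filter.IsBoundedUnder (· ≥ ·) (ae S.cellMeasure) fun p => min (f p) 1 := ⟨_, hlow⟩
  have hcob : Filter.IsCoboundedUnder (· ≥ ·) (ae S.cellMeasure) fun p => min (f p) 1 :=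
    Filter.IsBoundedUnder.isCoboundedUnder_ge
      (Filter.isBoundedUnder_of ⟨1, fun p => min_le_right _ _⟩)
  have hle := ae_essInf_le hb
  refine ⟨(lt_min hc one_pos).trans_le (le_essInf_of_ae_le _ hlow hcob), ?_,
    hle.mono fun p hp => hp.trans (min_le_left _ _)⟩
  obtain ⟨p, hp⟩ := hle.exists
  exact hp.trans (min_le_right _ _)

/-! ### Real and imaginary parts of the form on the diagonal -/

theorem sq_norm_eq_integral (f : S.L2Cell) : ‖f‖ ^ 2 = ∫ p, ‖f p‖ ^ 2 ∂S.cellMeasure := by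
  rw [← sq_norm_toLp (Lp.memLp f), Lp.toLp_coeFn]

theorem integrable_sq_norm_Lp (f : S.L2Cell) :
    Integrable (fun p => ‖f p‖ ^ 2) S.cellMeasure :=
  (memLp_two_iff_integrable_sq_norm (Lp.aestronglyMeasurable f)).1 (Lp.memLp f)

/-- The integrand of the squared `H¹(Ω)` seminorm. -/
def energyDensity (w : S.H1qp) (p : ℝ × ℝ) : ℝ := ‖d1 w p‖ ^ 2 + ‖d2 w p‖ ^ 2

theorem energyDensity_nonneg (w : S.H1qp) (p : ℝ × ℝ) : 0 ≤ energyDensity w p := by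
  unfold energyDensity; positivity

theorem integrable_energyDensity (w : S.H1qp) : Integrable (energyDensity w) S.cellMeasure :=
  (integrable_sq_norm_Lp _).add (integrable_sq_norm_Lp _)

theorem integral_energyDensity (w : S.H1qp) :
    ∫ p, energyDensity w p ∂S.cellMeasure = seminormSq w := by
  rw [seminormSq, sq_norm_eq_integral, sq_norm_eq_integral]
  exact integral_add (integrable_sq_norm_Lp _) (integrable_sq_norm_Lp _)

/-- Integrability of `|∇w|²` weighted by the reciprocal of a permittivity bounded away from zero. -/
theorem integrable_inv_mul_energyDensity {ε : ℝ × ℝ → ℂ} (hε : AEStronglyMeasurable ε S.cellMeasure)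
    {c : ℝ} (hc : 0 < c) (h : ∀ᵐ p ∂S.cellMeasure, c < (ε p).re) (w : S.H1qp) :
    Integrable (fun p => (ε p)⁻¹ * (energyDensity w p : ℂ)) S.cellMeasure := by
  refine (integrable_energyDensity w).ofReal.bdd_mul (c := c⁻¹)
    hε.aemeasurable.inv.aestronglyMeasurable (h.mono fun p hp => ?_)
  rw [norm_inv]
  exact inv_anti₀ hc (hp.le.trans (Complex.re_le_norm _))

/-- `Re ε > c` gives `|1/ε| ≤ 1/c`, so both parts of the volume integrand are integrable and the
integral splits. -/
theorem form_self {ε : ℝ × ℝ → ℂ} (hε : AEStronglyMeasurable ε S.cellMeasure)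
    {c : ℝ} (hc : 0 < c) (h : ∀ᵐ p ∂S.cellMeasure, c < (ε p).re) (w : S.H1qp) :
    form ε w w = (∫ p, (ε p)⁻¹ * (energyDensity w p : ℂ) ∂S.cellMeasure)
      - ((S.κ ^ 2 * ‖val w‖ ^ 2 : ℝ) : ℂ)
      - dtnForm S.epsBot (-S.H) w w - dtnForm S.epsTop S.H w w := by
  have hz : ∀ z : ℂ, z * conj z = ((‖z‖ ^ 2 : ℝ) : ℂ) := fun z => by
    rw [Complex.mul_conj, Complex.normSq_eq_norm_sq]
  have hint : Integrable (fun p => ((S.κ ^ 2 * ‖val w p‖ ^ 2 : ℝ) : ℂ)) S.cellMeasure :=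
    ((integrable_sq_norm_Lp (val w)).const_mul _).ofReal
  rw [sq_norm_eq_integral, ← integral_const_mul, ← integral_complex_ofReal,
    ← integral_sub (integrable_inv_mul_energyDensity hε hc h w) hint, form]
  congr 2
  refine integral_congr_ae (.of_forall fun p => ?_)
  simp only [hz, energyDensity]
  push_cast
  rfl

theorem mul_seminormSq_le_re {ε : ℝ × ℝ → ℂ} (hε : AEStronglyMeasurable ε S.cellMeasure)
    {c a : ℝ} (hc : 0 < c) (h : ∀ᵐ p ∂S.cellMeasure, c < (ε p).re)
    (ha : ∀ᵐ p ∂S.cellMeasure, a ≤ (ε p).re / ‖ε p‖ ^ 2) (w : S.H1qp) :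
    a * seminormSq w ≤ (∫ p, (ε p)⁻¹ * (energyDensity w p : ℂ) ∂S.cellMeasure).re := by
  have hi := integrable_inv_mul_energyDensity hε hc h w
  rw [← integral_energyDensity, ← integral_const_mul, ← RCLike.re_eq_complex_re, ← integral_re hi]
  refine integral_mono_ae ((integrable_energyDensity w).const_mul a) hi.re (ha.mono fun p hp => ?_)
  simp only [RCLike.re_eq_complex_re, Complex.re_mul_ofReal, Complex.inv_re,
    Complex.normSq_eq_norm_sq]
  exact mul_le_mul_of_nonneg_right hp (energyDensity_nonneg w p)

/-- `Im (1/ε) = -Im ε / |ε|²`, whence the minus sign: absorption makes the imaginary part negative.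
-/
theorem mul_seminormSq_le_neg_im {ε : ℝ × ℝ → ℂ} (hε : AEStronglyMeasurable ε S.cellMeasure)
    {c a : ℝ} (hc : 0 < c) (h : ∀ᵐ p ∂S.cellMeasure, c < (ε p).re)
    (ha : ∀ᵐ p ∂S.cellMeasure, a ≤ (ε p).im / ‖ε p‖ ^ 2) (w : S.H1qp) :
    a * seminormSq w ≤ -(∫ p, (ε p)⁻¹ * (energyDensity w p : ℂ) ∂S.cellMeasure).im := by
  have hi := integrable_inv_mul_energyDensity hε hc h w
  rw [← integral_energyDensity, ← integral_const_mul, ← RCLike.im_eq_complex_im, ← integral_im hi,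
    ← integral_neg]
  refine integral_mono_ae ((integrable_energyDensity w).const_mul a) hi.im.neg
    (ha.mono fun p hp => ?_)
  simp only [RCLike.im_eq_complex_im, Complex.im_mul_ofReal, Complex.inv_im,
    Complex.normSq_eq_norm_sq]
  rw [neg_div, neg_mul, neg_neg]
  exact mul_le_mul_of_nonneg_right hp (energyDensity_nonneg w p)

/-! ### The coercivity estimate -/

/-- A lower bound for the modulus from a weighted bound on real and imaginary parts. -/
theorem le_norm_of_le_re_sub_im {z : ℂ} {m r : ℝ} (hm : 0 ≤ m)
    (h : m ≤ z.re - r * z.im) : m / √(1 + 2 * r ^ 2) ≤ ‖z‖ := by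
  rw [div_le_iff₀ (by positivity)]
  refine abs_le_of_sq_le_sq' ?_ (by positivity) |>.2
  rw [mul_pow, Real.sq_sqrt (by positivity), ← Complex.normSq_eq_norm_sq, Complex.normSq_apply]
  have h1 := pow_le_pow_left₀ hm h 2
  -- `(Re z - r Im z)² + (r Re z + Im z)² = (1 + r²) |z|²`, so even `1 + r²` would do.
  nlinarith [sq_nonneg (r * z.re + z.im), sq_nonneg (r * z.re), sq_nonneg (r * z.im)]

/-- The coefficients `Re ε / |ε|²` and `Im ε / |ε|²` are bounded away from zero. -/
theorem exists_pos_le_div_sq_norm {ε : ℝ × ℝ → ℂ} (hε : MemLp ε ∞ S.cellMeasure) {c : ℝ}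
    (hc : 0 < c) {f : ℝ × ℝ → ℝ} (hf : ∀ᵐ p ∂S.cellMeasure, c < f p)
    (hfε : ∀ p, f p ≤ ‖ε p‖) :
    ∃ a, 0 < a ∧ ∀ᵐ p ∂S.cellMeasure, a ≤ f p / ‖ε p‖ ^ 2 := by
  have htop : eLpNormEssSup ε S.cellMeasure ≠ ⊤ := by
    rw [← eLpNorm_exponent_top]; exact hε.eLpNorm_ne_top
  set K := (eLpNormEssSup ε S.cellMeasure).toReal
  refine ⟨c / (K + 1) ^ 2, by positivity, ?_⟩
  filter_upwards [hf, ae_le_eLpNormEssSup (f := ε) (μ := S.cellMeasure)] with p hp hK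
  have h1 : ‖ε p‖ ≤ K + 1 := by
    have := ENNReal.toReal_mono htop hK
    rw [toReal_enorm] at this
    linarith
  have h2 : 0 < ‖ε p‖ := hc.trans (hp.trans_le (hfε p))
  exact div_le_div₀ (hc.trans hp).le hp.le (by positivity) (pow_le_pow_left₀ h2.le h1 2)

theorem sigma_lam_pos {ε : ℝ × ℝ → ℂ} {c₁ c₂ : ℝ} (hε : MemLp ε ∞ S.cellMeasure) (hc₁ : 0 < c₁)
    (hc₂ : 0 < c₂) (him : ∀ᵐ p ∂S.cellMeasure, c₁ < (ε p).im)
    (hre : ∀ᵐ p ∂S.cellMeasure, c₂ < (ε p).re) {C : ℝ} (hC : 0 < C) :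
    0 < S.sigma ε ∧ 0 < S.lam C⁻¹ ε := by
  obtain ⟨a, ha, ha'⟩ := exists_pos_le_div_sq_norm hε hc₁ him fun p => Complex.im_le_norm _
  obtain ⟨b, hb, hb'⟩ := exists_pos_le_div_sq_norm hε hc₂ hre fun p => Complex.re_le_norm _
  exact ⟨(pos_le_essInf_min_one hb hb').1,
    mul_pos (inv_pos.2 hC) (pos_le_essInf_min_one ha ha').1⟩

/-- The coercivity estimate, given a constant in the Poincaré inequality. -/
theorem sigma_div_mul_sq_norm_le {C : ℝ} (hC : 0 < C)
    (hP : ∀ w : S.H1qp, ‖val w‖ ^ 2 ≤ C * (seminormSq w + (dtnForm S.epsTop S.H w w).im))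
    {ε : ℝ × ℝ → ℂ} {c₁ c₂ : ℝ} (hε : MemLp ε ∞ S.cellMeasure) (hc₁ : 0 < c₁) (hc₂ : 0 < c₂)
    (him : ∀ᵐ p ∂S.cellMeasure, c₁ < (ε p).im) (hre : ∀ᵐ p ∂S.cellMeasure, c₂ < (ε p).re)
    (w : S.H1qp) :
    S.sigma ε / √(1 + 2 * (S.gam / S.lam C⁻¹ ε) ^ 2) * ‖w‖ ^ 2 ≤ ‖form ε w w‖ := by
  have hH := S.H_pos
  have hbot : -S.H ∈ Set.Icc (-S.H) S.H := Set.left_mem_Icc.2 (by linarith)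
  have htop : S.H ∈ Set.Icc (-S.H) S.H := Set.right_mem_Icc.2 (by linarith)
  obtain ⟨hσ, hlam⟩ := sigma_lam_pos hε hc₁ hc₂ him hre hC
  obtain ⟨a, ha, ha'⟩ := exists_pos_le_div_sq_norm hε hc₁ him fun p => Complex.im_le_norm _
  obtain ⟨b, hb, hb'⟩ := exists_pos_le_div_sq_norm hε hc₂ hre fun p => Complex.re_le_norm _
  obtain ⟨hτ, hτ1, hτle⟩ := pos_le_essInf_min_one ha ha'
  obtain ⟨-, hσ1, hσle⟩ := pos_le_essInf_min_one hb hb'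
  have hR := mul_seminormSq_le_re hε.1 hc₂ hre hσle w
  have hI := mul_seminormSq_le_neg_im hε.1 hc₂ hre hτle w
  have hr1 := dtnForm_self_re_nonpos S.epsBot_pos hbot w
  have hr2 := dtnForm_self_re_nonpos S.epsTop_pos htop w
  have hi1 := dtnForm_self_im_nonneg S.epsBot_pos hbot w
  have hi2 := dtnForm_self_im_nonneg S.epsTop_pos htop w
  have hPw := hP w
  have hform := form_self hε.1 hc₂ hre w
  have hB : (form ε w w).re = _ := congrArg Complex.re hform
  have hB' : (form ε w w).im = _ := congrArg Complex.im hform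
  simp only [Complex.sub_re, Complex.sub_im, Complex.ofReal_re, Complex.ofReal_im] at hB hB'
  change S.sigma ε * _ ≤ _ at hR
  change S.sigma ε ≤ 1 at hσ1
  have hlamdef : S.lam C⁻¹ ε =
      C⁻¹ * essInf (fun p => min ((ε p).im / ‖ε p‖ ^ 2) 1) S.cellMeasure := rfl
  set τ := essInf (fun p => min ((ε p).im / ‖ε p‖ ^ 2) 1) S.cellMeasure
  set N := ‖val w‖ ^ 2
  set D := (dtnForm S.epsTop S.H w w).im
  have hgam : 0 < S.gam := by unfold gam; positivity
  -- The cap `τ ≤ 1` lets the top DtN term absorb `τ D`; the bottom one is dropped by sign.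
  have him' : S.lam C⁻¹ ε * N ≤ -(form ε w w).im := by
    have h1 : C⁻¹ * N ≤ seminormSq w + D := (inv_mul_le_iff₀ hC).2 hPw
    have h2 := mul_le_mul_of_nonneg_left h1 hτ.le
    have h3 : τ * D ≤ D := mul_le_of_le_one_left hi2 hτ1
    rw [hlamdef]
    linarith
  have hγ : S.gam * N ≤ -(S.gam / S.lam C⁻¹ ε * (form ε w w).im) := by
    have h1 := mul_le_mul_of_nonneg_left him' (div_pos hgam hlam).le
    rw [← mul_assoc, div_mul_cancel₀ _ hlam.ne'] at h1
    linarith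
  rw [div_mul_eq_mul_div]
  refine le_norm_of_le_re_sub_im (by positivity) ?_
  rw [norm_sq_eq]
  -- Of `γ = κ² + 1`, the `κ²` cancels the negative volume term and the `1` leaves `N ≥ σ N`, which
  -- completes the full norm.
  have hN : S.sigma ε * N ≤ N := mul_le_of_le_one_left (sq_nonneg _) hσ1
  have hγN : S.gam * N = S.κ ^ 2 * N + N := by rw [gam]; ring
  linarith

end RCWA.Setup

end

/-! ### The theorem -/

theorem corollary2 (S : RCWA.Setup) :
    (∀ w v : S.H1qp,
      Summable (RCWA.Setup.dtnTerm S.epsTop S.H w v) ∧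
      Summable (RCWA.Setup.dtnTerm S.epsBot (-S.H) w v)) ∧
    ∃ C : ℝ, 0 < C ∧
      (∀ w : S.H1qp, ‖RCWA.Setup.val w‖ ^ 2 ≤
        C * (RCWA.Setup.seminormSq w + (RCWA.Setup.dtnForm S.epsTop S.H w w).im)) ∧
      ∀ (ε : ℝ × ℝ → ℂ) (c₁ c₂ : ℝ), MemLp ε ∞ S.cellMeasure → 0 < c₁ → 0 < c₂ →
        (∀ᵐ p ∂S.cellMeasure, c₁ < (ε p).im) → (∀ᵐ p ∂S.cellMeasure, c₂ < (ε p).re) →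
          RCWA.Setup.Coercive (RCWA.Setup.form (S := S) ε) ∧
          0 < S.sigma ε ∧ 0 < S.lam C⁻¹ ε ∧
          ∀ w : S.H1qp,
            S.sigma ε / √(1 + 2 * (S.gam / S.lam C⁻¹ ε) ^ 2) * ‖w‖ ^ 2 ≤
              ‖RCWA.Setup.form ε w w‖ := by
  have hH := S.H_pos
  have hbot : -S.H ∈ Set.Icc (-S.H) S.H := Set.left_mem_Icc.2 (by linarith)
  have htop : S.H ∈ Set.Icc (-S.H) S.H := Set.right_mem_Icc.2 (by linarith)
  refine ⟨fun w v => ⟨RCWA.Setup.summable_dtnTerm S.epsTop_pos htop w v,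
    RCWA.Setup.summable_dtnTerm S.epsBot_pos hbot w v⟩, ?_⟩
  -- `C` is fixed before `ε` is introduced, so it depends only on `S`.
  obtain ⟨C, hC, hP⟩ := S.exists_poincare_constant
  refine ⟨C, hC, hP, fun ε c₁ c₂ hε hc₁ hc₂ him hre => ?_⟩
  have hpos := RCWA.Setup.sigma_lam_pos hε hc₁ hc₂ him hre hC
  have hle := RCWA.Setup.sigma_div_mul_sq_norm_le hC hP hε hc₁ hc₂ him hre
  exact ⟨⟨_, div_pos hpos.1 (by positivity), hle⟩, hpos.1, hpos.2, hle⟩
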